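/- Let $\mathbf{K}$ be a strict $2$-category. Let $\mathsf{Mnd}(\mathbf{K})$ be the $2$-category of monads in $\mathbf{K}$: its objects are pairs $(\mathbb{X},S)$ of an object and a monad $(S,\eta,\mu)$ on it; a $1$-morphism $(\mathbb{X},S)\to(\mathbb{X}',S')$ is a $1$-morphism $F\colon\mathbb{X}\to\mathbb{X}'$ with a $2$-morphism $\alpha\colon S'\circ F\Rightarrow F\circ S$ compatible with units and multiplications; a $2$-morphism is a $2$-morphism $F\Rightarrow G$ compatible with these $\alpha$'s. Let $\mathsf{Inc}\colon\mathbf{K}\to\mathsf{Mnd}(\mathbf{K})$ be the $2$-functor sending $\mathbb{X}$ to the identity monad on $\mathbb{X}$. A *construction of algebras* for $\mathbf{K}$ is a right $2$-adjoint $\mathsf{Alg}$ of $\mathsf{Inc}$; $\mathbf{K}$ *admits the construction of algebras* if one exists. The counit of $\mathsf{Inc}\dashv\mathsf{Alg}$ at $(\mathbb{X},S)$ is a morphism of monads $\mathsf{Inc}(\mathsf{Alg}(S))\to(\mathbb{X},S)$; its underlying $1$-morphism $\mathrm{U}\colon\mathsf{Alg}(S)\to\mathbb{X}$ is the forgetful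 $1$-morphism. A limit in a hom-category $\mathbf{K}(\mathbb{X},\mathbb{Y})$ is *pointwise* if it is preserved by precomposition with every $1$-morphism $\mathbb{X}'\to\mathbb{X}$. A *tangent structure* $\mathbb{T}$ on an object $\mathbb{X}$ consists of a $1$-morphism $\mathrm{T}\colon\mathbb{X}\to\mathbb{X}$ and $2$-morphisms $p\colon\mathrm{T}\Rightarrow\mathsf{id}_{\mathbb{X}}$, $z\colon\mathsf{id}_{\mathbb{X}}\Rightarrow\mathrm{T}$, $s\colon\mathrm{T}_2\Rightarrow\mathrm{T}$, $l\colon\mathrm{T}\Rightarrow\mathrm{T}^2$, $c\colon\mathrm{T}^2\Rightarrow\mathrm{T}^2$, such that: - for every $n\ge1$ the $n$-fold pullback $\mathrm{T}_n$ of $p$ along itself exists, is pointwise, and is preserved, together with its pointwise universal property, by postcomposition with all iterates of $\mathrm{T}$; and $\mathbf{p}=(p,z,s)$ is an additive bundle, i.e. a commutative monoid over $\mathsf{id}_{\mathbb{X}}$, in the category of endomorphisms of $\mathbb{X}$; - $(z,l)\colon\mathbf{p}\to\mathrm{T}\mathbf{p}$ and $(\mathsf{id},c)\colon\mathrm{T}\mathbf{p}\to\mathbf{p}_{\mathrm{T}}$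 are additive bundle morphisms (compatible with projections, zeros and sums); - $\mathrm{T}l\cdot l=l_{\mathrm{T}}\cdot l$, $c\cdot l=l$, $c_{\mathrm{T}}\cdot\mathrm{T}c\cdot l_{\mathrm{T}}=\mathrm{T}l\cdot c$, $c\cdot c=\mathsf{id}$, and $\mathrm{T}c\cdot c_{\mathrm{T}}\cdot\mathrm{T}c=c_{\mathrm{T}}\cdot\mathrm{T}c\cdot c_{\mathrm{T}}$; - the square with sides $\mathrm{T}s\cdot(z_{\mathrm{T}}\times l)\colon\mathrm{T}_2\Rightarrow\mathrm{T}^2$, $\mathrm{T}p\colon\mathrm{T}^2\Rightarrow\mathrm{T}$, $p\cdot\pi_1\colon\mathrm{T}_2\Rightarrow\mathsf{id}_{\mathbb{X}}$ and $z\colon\mathsf{id}_{\mathbb{X}}\Rightarrow\mathrm{T}$ is a pointwise pullback. A *tangentad* of $\mathbf{K}$ is an object with a tangent structure. A *lax tangent $1$-morphism* $(\mathbb{X},\mathbb{T})\to(\mathbb{X}',\mathbb{T}')$ is a $1$-morphism $F\colon\mathbb{X}\to\mathbb{X}'$ with a $2$-morphism $\alpha\colon F\circ\mathrm{T}\Rightarrow\mathrm{T}'\circ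 F$ such that $(\mathsf{id}_F,\alpha)\colon F\mathbf{p}\to\mathbf{p}'_F$ is an additive bundle morphism, $\mathrm{T}'\alpha\cdot\alpha_{\mathrm{T}}\cdot Fl=l'_F\cdot\alpha$ and $\mathrm{T}'\alpha\cdot\alpha_{\mathrm{T}}\cdot Fc=c'_F\cdot\mathrm{T}'\alpha\cdot\alpha_{\mathrm{T}}$; it is *strict* if $F\circ\mathrm{T}=\mathrm{T}'\circ F$ and $\alpha$ is the identity. A *tangent $2$-morphism* $(F,\alpha)\Rightarrow(G,\beta)$ is a $2$-morphism $\varphi\colon F\Rightarrow G$ with $\mathrm{T}'\varphi\cdot\alpha=\beta\cdot\varphi_{\mathrm{T}}$. These form a $2$-category $\mathsf{Tng}(\mathbf{K})$. A *tangent monad* is a monad $M$ in $\mathsf{Tng}(\mathbf{K})$, that is, a tangentad $(\mathbb{X},\mathbb{T})$ with a monad on it whose underlying $1$-morphism is a lax tangent $1$-morphism $(S,\alpha)$; it has an underlying monad $(\mathbb{X},S)$ in $\mathbf{K}$. **Theorem.** If $\mathbf{K}$ admits the construction of algebras, then so does $\mathsf{Tng}(\mathbf{K})$. More precisely, for every construction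 of algebras $\mathsf{Alg}$ for $\mathbf{K}$ there is a construction of algebras $\mathsf{Alg}'$ for $\mathsf{Tng}(\mathbf{K})$ such that, for every tangent monad $M=(\mathbb{X},\mathbb{T};S,\alpha)$ of $\mathbf{K}$, $\mathsf{Alg}'(M)=(\mathsf{Alg}(S),\mathbb{T}^S)$ for some tangent structure $\mathbb{T}^S$ on the Eilenberg–Moore object $\mathsf{Alg}(S)$ of the underlying monad, the counit of $\mathsf{Alg}'$ at $M$ has as underlying morphism of monads in $\mathbf{K}$ the counit of $\mathsf{Alg}$ at $(\mathbb{X},S)$, and its $1$-morphism $\mathrm{U}\colon(\mathsf{Alg}(S),\mathbb{T}^S)\to(\mathbb{X},\mathbb{T})$ is a strict tangent $1$-morphism. -/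

import Mathlib

open CategoryTheory Bicategory Limits

universe w v u w₁ v₁ u₁ w₂ v₂ u₂

namespace Tangent

section AdditiveBundles

variable {C : Type u} [Category.{v} C] {D : Type u₁} [Category.{v₁} D]

/-- The data underlying an additive bundle in a category: the projection `q : E ⟶ B`, the zero
morphism `B ⟶ E`, the sum morphism `E₂ ⟶ E`, and the two projections `E₂ ⟶ E`. -/
structure BundleData (C : Type u) [Category.{v} C] where
  base : C
  total : C
  total₂ : C
  proj : total ⟶ base
  zero : base ⟶ total
  sum : total₂ ⟶ total
  fst : total₂ ⟶ total
  snd : total₂ ⟶ total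

/-- The image of bundle data under a functor. -/
@[simps]
def BundleData.map (q : BundleData C) (F : C ⥤ D) : BundleData D where
  base := F.obj q.base
  total := F.obj q.total
  total₂ := F.obj q.total₂
  proj := F.map q.proj
  zero := F.map q.zero
  sum := F.map q.sum
  fst := F.map q.fst
  snd := F.map q.snd

/-- The morphisms `π i : P ⟶ E` (with common composite `b : P ⟶ B`) exhibit `P` as the `n`-fold
pullback of `q : E ⟶ B` along itself. -/
def IsNFoldPullback {E B P : C} (q : E ⟶ B) {n : ℕ} (π : Fin n → (P ⟶ E)) (b : P ⟶ B) : Prop :=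
  ∃ h : ∀ i, π i ≫ q = b, Nonempty (IsLimit (WidePullbackCone.mk b π h))

/-- The axioms of an additive bundle. Associativity is stated on triples of generalized elements
of `E` over the same element of `B`, that is, on maps into the `3`-fold pullback. -/
structure BundleData.IsAdditive (q : BundleData C) : Prop where
  exists_pullback : ∀ n : ℕ, 0 < n →
    ∃ (P : C) (π : Fin n → (P ⟶ q.total)) (b : P ⟶ q.base), IsNFoldPullback q.proj π b
  isPullback : IsPullback q.fst q.snd q.proj q.proj
  zero_proj : q.zero ≫ q.proj = 𝟙 q.base
  sum_proj : q.sum ≫ q.proj = q.fst ≫ q.proj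
  sum_assoc : ∀ {H : C} (x y z : H ⟶ q.total) (hxy : x ≫ q.proj = y ≫ q.proj)
    (hyz : y ≫ q.proj = z ≫ q.proj),
    isPullback.lift (isPullback.lift x y hxy ≫ q.sum) z
        (by rw [Category.assoc, sum_proj, IsPullback.lift_fst_assoc, hxy, hyz]) ≫ q.sum =
      isPullback.lift x (isPullback.lift y z hyz ≫ q.sum)
        (by rw [Category.assoc, sum_proj, IsPullback.lift_fst_assoc, hxy]) ≫ q.sum
  sum_unit : isPullback.lift (q.proj ≫ q.zero) (𝟙 q.total)
    (by rw [Category.assoc, zero_proj, Category.comp_id, Category.id_comp]) ≫ q.sum = 𝟙 q.total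
  sum_comm : isPullback.lift q.snd q.fst isPullback.w.symm ≫ q.sum = q.sum

/-- `(f, g)` is an additive bundle morphism from `q` to `q'`; the morphism `g₂` is `g ×_f g`. -/
structure IsAdditiveHom (q q' : BundleData C) (f : q.base ⟶ q'.base) (g : q.total ⟶ q'.total) :
    Prop where
  proj : g ≫ q'.proj = q.proj ≫ f
  zero : q.zero ≫ g = f ≫ q'.zero
  sum : ∃ g₂ : q.total₂ ⟶ q'.total₂,
    g₂ ≫ q'.fst = q.fst ≫ g ∧ g₂ ≫ q'.snd = q.snd ≫ g ∧ q.sum ≫ g = g₂ ≫ q'.sum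

end AdditiveBundles

section Tangentads

variable {K : Type u} [Bicategory.{w, v} K]

/-! Throughout, `f ≫ g` is the composite `g ∘ f` of `1`-morphisms. Hence `F ◁ φ` is `φ` precomposed
with `F` (written `φ_F` in function notation), and `φ ▷ F` is `φ` postcomposed with `F`
(written `F φ`). -/

/-- The iterates of an endomorphism. -/
def iter {X : K} (T : X ⟶ X) : ℕ → (X ⟶ X)
  | 0 => 𝟙 X
  | n + 1 => iter T n ≫ T

/-- The functor `L ↦ H ∘ L ∘ G` between hom-categories. -/
abbrev whiskerBoth {X' X Y Y' : K} (G : X' ⟶ X) (H : Y ⟶ Y') : (X ⟶ Y) ⥤ (X' ⟶ Y') :=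
  precomp Y G ⋙ postcomp X' H

/-- The canonical comparison `F ∘ id ⟶ id ∘ F` (an identity in a strict `2`-category). -/
def unitLaw {X Y : K} (F : X ⟶ Y) : 𝟙 X ≫ F ⟶ F ≫ 𝟙 Y := (λ_ F).hom ≫ (ρ_ F).inv

/-- The data of a tangent structure on an object: tangent bundle `1`-morphism, the `2`-fold pullback
of the projection with its two projections, and the structural `2`-morphisms. -/
structure TangentData (X : K) where
  T : X ⟶ X
  T₂ : X ⟶ X
  p : T ⟶ 𝟙 X
  π₁ : T₂ ⟶ T
  π₂ : T₂ ⟶ T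
  z : 𝟙 X ⟶ T
  s : T₂ ⟶ T
  l : T ⟶ T ≫ T
  c : T ≫ T ⟶ T ≫ T

/-- The bundle data `(p, z, s)` in the category of endomorphisms of `X`. -/
@[simps]
def TangentData.bundle {X : K} (t : TangentData X) : BundleData (X ⟶ X) where
  base := 𝟙 X
  total := t.T
  total₂ := t.T₂
  proj := t.p
  zero := t.z
  sum := t.s
  fst := t.π₁
  snd := t.π₂

/-- A tangent structure on an object `X`. -/
structure TangentStructure (X : K) extends TangentData X where
  /-- `(p, z, s)` is an additive bundle. -/
  additive : toTangentData.bundle.IsAdditive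
  /-- The projection admits all `n`-fold pullbacks along itself; these are pointwise and preserved
  by the iterates of `T`. -/
  exists_pullback : ∀ n : ℕ, 0 < n →
    ∃ (Tn : X ⟶ X) (π : Fin n → (Tn ⟶ T)) (b : Tn ⟶ 𝟙 X),
      ∀ (X' : K) (G : X' ⟶ X) (m : ℕ),
        IsNFoldPullback ((whiskerBoth G (iter T m)).map p)
          (fun i ↦ (whiskerBoth G (iter T m)).map (π i)) ((whiskerBoth G (iter T m)).map b)
  /-- The chosen `2`-fold pullback is pointwise and preserved by the iterates of `T`. -/
  isPullback : ∀ (X' : K) (G : X' ⟶ X) (m : ℕ),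
    IsPullback ((whiskerBoth G (iter T m)).map π₁) ((whiskerBoth G (iter T m)).map π₂)
      ((whiskerBoth G (iter T m)).map p) ((whiskerBoth G (iter T m)).map p)
  /-- `(z, l)` is an additive bundle morphism `𝐩 ⟶ T 𝐩`. -/
  lift_additive : IsAdditiveHom toTangentData.bundle (toTangentData.bundle.map (postcomp X T))
    (z ≫ (λ_ T).inv) l
  /-- `(id, c)` is an additive bundle morphism `T 𝐩 ⟶ 𝐩_T`. -/
  flip_additive : IsAdditiveHom (toTangentData.bundle.map (postcomp X T))
    (toTangentData.bundle.map (precomp X T)) (unitLaw T) c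
  lift_coassoc : l ≫ l ▷ T ≫ (α_ T T T).hom = l ≫ T ◁ l
  lift_flip : l ≫ c = l
  lift_flip_flip : T ◁ l ≫ (α_ T T T).inv ≫ c ▷ T ≫ (α_ T T T).hom ≫ T ◁ c =
    c ≫ l ▷ T ≫ (α_ T T T).hom
  flip_flip : c ≫ c = 𝟙 (T ≫ T)
  flip_braid :
    c ▷ T ≫ (α_ T T T).hom ≫ T ◁ c ≫ (α_ T T T).inv ≫ c ▷ T =
      (α_ T T T).hom ≫ T ◁ c ≫ (α_ T T T).inv ≫ c ▷ T ≫ (α_ T T T).hom ≫ T ◁ c ≫ (α_ T T T).inv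
  /-- The tangent bundle is locally linear; `ν : T₂ ⟶ T ∘ T₂` is `z_T × l`, and the pullback
  is pointwise. -/
  locally_linear : ∃ ν : T₂ ⟶ T₂ ≫ T,
    ν ≫ π₁ ▷ T = π₁ ≫ (ρ_ T).inv ≫ T ◁ z ∧ ν ≫ π₂ ▷ T = π₂ ≫ l ∧
    ∀ (X' : K) (G : X' ⟶ X),
      IsPullback (G ◁ (ν ≫ s ▷ T)) (G ◁ (π₁ ≫ p)) (G ◁ (p ▷ T ≫ (λ_ T).hom)) (G ◁ z)

variable (K) in
/-- A tangentad of `K`: an object with a tangent structure. -/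
structure Tng where
  obj : K
  str : TangentStructure obj

/-- For `α : F ∘ T ⟶ T' ∘ F`, the composite `T'α ∘ α_T : F ∘ T² ⟶ T'² ∘ F`. -/
def lawSq {X Y : K} {T : X ⟶ X} {T' : Y ⟶ Y} {F : X ⟶ Y} (α : T ≫ F ⟶ F ≫ T') :
    (T ≫ T) ≫ F ⟶ F ≫ T' ≫ T' :=
  (α_ T T F).hom ≫ T ◁ α ≫ (α_ T F T').inv ≫ α ▷ T' ≫ (α_ F T' T').hom

/-- The conditions on a lax distributive law `α : F ∘ T ⟶ T' ∘ F`. -/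
structure IsLaxLaw {X Y : K} (t : TangentStructure X) (t' : TangentStructure Y) (F : X ⟶ Y)
    (α : t.T ≫ F ⟶ F ≫ t'.T) : Prop where
  additive : IsAdditiveHom (t.bundle.map (postcomp X F)) (t'.bundle.map (precomp Y F))
    (unitLaw F) α
  lift : t.l ▷ F ≫ lawSq α = α ≫ F ◁ t'.l
  flip : t.c ▷ F ≫ lawSq α = lawSq α ≫ F ◁ t'.c

namespace Tng

/-- Lax tangent `1`-morphisms. -/
structure Hom (A B : Tng K) where
  hom : A.obj ⟶ B.obj
  law : A.str.T ≫ hom ⟶ hom ≫ B.str.T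
  isLaxLaw : IsLaxLaw A.str B.str hom law

/-- Tangent `2`-morphisms. -/
@[ext]
structure Hom₂ {A B : Tng K} (F G : Hom A B) where
  hom : F.hom ⟶ G.hom
  comm : F.law ≫ hom ▷ B.str.T = A.str.T ◁ hom ≫ G.law

/-- A lax tangent `1`-morphism is strict when its distributive law is an identity. -/
def Hom.IsStrict {A B : Tng K} (F : Hom A B) : Prop :=
  ∃ h : A.str.T ≫ F.hom = F.hom ≫ B.str.T, F.law = eqToHom h

end Tng

theorem isAdditiveHom_iff {X Y : K} (t : TangentStructure X) (t' : TangentStructure Y) (F : X ⟶ Y)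
    (α : t.T ≫ F ⟶ F ≫ t'.T) :
    IsAdditiveHom (t.bundle.map (postcomp X F)) (t'.bundle.map (precomp Y F))
      (unitLaw F) α ↔
    α ≫ F ◁ t'.p = t.p ▷ F ≫ unitLaw F ∧
    t.z ▷ F ≫ α = unitLaw F ≫ F ◁ t'.z ∧
    ∃ α₂ : t.T₂ ≫ F ⟶ F ≫ t'.T₂, α₂ ≫ F ◁ t'.π₁ = t.π₁ ▷ F ≫ α ∧
      α₂ ≫ F ◁ t'.π₂ = t.π₂ ▷ F ≫ α ∧ t.s ▷ F ≫ α = α₂ ≫ F ◁ t'.s :=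
  ⟨fun h ↦ ⟨h.1, h.2, h.3⟩, fun h ↦ ⟨h.1, h.2.1, h.2.2⟩⟩

/-- The distributive law of a composite. -/
def compLaw {X Y Z : K} {T : X ⟶ X} {T' : Y ⟶ Y} {T'' : Z ⟶ Z} {F : X ⟶ Y} {G : Y ⟶ Z}
    (α : T ≫ F ⟶ F ≫ T') (β : T' ≫ G ⟶ G ≫ T'') : T ≫ F ≫ G ⟶ (F ≫ G) ≫ T'' :=
  (α_ T F G).inv ≫ α ▷ G ≫ (α_ F T' G).hom ≫ F ◁ β ≫ (α_ F G T'').inv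

theorem lawSq_compLaw {X Y Z : K} {T : X ⟶ X} {T' : Y ⟶ Y} {T'' : Z ⟶ Z} {F : X ⟶ Y} {G : Y ⟶ Z}
    (α : T ≫ F ⟶ F ≫ T') (β : T' ≫ G ⟶ G ≫ T'') :
    lawSq (compLaw α β) = compLaw (lawSq α) (lawSq β) := by
  have : lawSq (compLaw α β) = 𝟙 _ ⊗≫ T ◁ α ▷ G ⊗≫ (α ▷ (T' ≫ G) ≫ (F ≫ T') ◁ β) ⊗≫
      F ◁ β ▷ T'' ⊗≫ 𝟙 _ := by
    rw [← whisker_exchange]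
    simp only [lawSq, compLaw]
    bicategory
  rw [this]
  simp only [lawSq, compLaw]
  bicategory

/-- Squares of `2`-morphisms paste along `compLaw`. -/
theorem compLaw_square {X Y Z : K} {S T : X ⟶ X} {S' T' : Y ⟶ Y} {S'' T'' : Z ⟶ Z}
    {F : X ⟶ Y} {G : Y ⟶ Z} {φ : S ⟶ T} {φ' : S' ⟶ T'} {φ'' : S'' ⟶ T''}
    {σ : S ≫ F ⟶ F ≫ S'} {σ' : S' ≫ G ⟶ G ≫ S''}
    {α : T ≫ F ⟶ F ≫ T'} {β : T' ≫ G ⟶ G ≫ T''}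
    (h : φ ▷ F ≫ α = σ ≫ F ◁ φ') (h' : φ' ▷ G ≫ β = σ' ≫ G ◁ φ'') :
    φ ▷ (F ≫ G) ≫ compLaw α β = compLaw σ σ' ≫ (F ≫ G) ◁ φ'' := by
  have e : φ ▷ (F ≫ G) ≫ compLaw α β = 𝟙 _ ⊗≫ (φ ▷ F ≫ α) ▷ G ⊗≫ F ◁ β ⊗≫ 𝟙 _ := by
    simp only [compLaw]; bicategory
  have e' : compLaw σ σ' ≫ (F ≫ G) ◁ φ'' = 𝟙 _ ⊗≫ σ ▷ G ⊗≫ F ◁ (σ' ≫ G ◁ φ'') ⊗≫ 𝟙 _ := by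
    simp only [compLaw]; bicategory
  rw [e, e', h, ← h']
  bicategory

/-- The distributive law of an identity. -/
def idLaw {X : K} (T : X ⟶ X) : T ≫ 𝟙 X ⟶ 𝟙 X ≫ T := (ρ_ T).hom ≫ (λ_ T).inv

theorem compLaw_unitLaw {X Y Z : K} (F : X ⟶ Y) (G : Y ⟶ Z) :
    compLaw (unitLaw F) (unitLaw G) = unitLaw (F ≫ G) := by
  simp only [compLaw, unitLaw]; bicategory

theorem isLaxLaw_id {X : K} (t : TangentStructure X) : IsLaxLaw t t (𝟙 X) (idLaw t.T) where
  additive := by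
    rw [isAdditiveHom_iff]
    refine ⟨?_, ?_, idLaw t.T₂, ?_, ?_, ?_⟩ <;> simp [unitors_equal, idLaw, unitLaw]
  lift := by
    simp only [lawSq, idLaw]
    simp
  flip := by
    simp only [lawSq, idLaw]
    simp

theorem isLaxLaw_comp {X Y Z : K} {t : TangentStructure X} {t' : TangentStructure Y}
    {t'' : TangentStructure Z} {F : X ⟶ Y} {G : Y ⟶ Z} {α : t.T ≫ F ⟶ F ≫ t'.T}
    {β : t'.T ≫ G ⟶ G ≫ t''.T} (hα : IsLaxLaw t t' F α) (hβ : IsLaxLaw t' t'' G β) :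
    IsLaxLaw t t'' (F ≫ G) (compLaw α β) where
  additive := by
    obtain ⟨a1, a2, u, a3, a4, a5⟩ := (isAdditiveHom_iff ..).1 hα.additive
    obtain ⟨b1, b2, w, b3, b4, b5⟩ := (isAdditiveHom_iff ..).1 hβ.additive
    rw [isAdditiveHom_iff]
    refine ⟨?_, ?_, compLaw u w, (compLaw_square a3.symm b3.symm).symm,
      (compLaw_square a4.symm b4.symm).symm, compLaw_square a5 b5⟩
    · exact (compLaw_square a1.symm b1.symm).symm.trans (by rw [compLaw_unitLaw])
    · exact (compLaw_square a2 b2).trans (by rw [compLaw_unitLaw])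
  lift := by
    rw [lawSq_compLaw]
    exact compLaw_square hα.lift hβ.lift
  flip := by
    rw [lawSq_compLaw]
    exact compLaw_square hα.flip hβ.flip

section CompLaw

variable {X Y Z W : K} {T : X ⟶ X} {T' : Y ⟶ Y} {T'' : Z ⟶ Z} {T₃ : W ⟶ W}

theorem compLaw_whiskerLeft {F : X ⟶ Y} {G H : Y ⟶ Z} (α : T ≫ F ⟶ F ≫ T')
    {β : T' ≫ G ⟶ G ≫ T''} {γ : T' ≫ H ⟶ H ≫ T''} {φ : G ⟶ H}
    (h : β ≫ φ ▷ T'' = T' ◁ φ ≫ γ) :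
    compLaw α β ≫ (F ◁ φ) ▷ T'' = T ◁ (F ◁ φ) ≫ compLaw α γ := by
  calc _ = (α_ _ _ _).inv ≫ α ▷ G ≫ (α_ _ _ _).hom ≫
        F ◁ (β ≫ φ ▷ T'') ≫ (α_ _ _ _).inv := by simp [compLaw]
    _ = (α_ _ _ _).inv ≫ (α ▷ G ≫ (F ≫ T') ◁ φ) ≫ (α_ _ _ _).hom ≫
        F ◁ γ ≫ (α_ _ _ _).inv := by rw [h]; simp
    _ = _ := by rw [← whisker_exchange]; simp [compLaw]

theorem compLaw_whiskerRight {F G : X ⟶ Y} {H : Y ⟶ Z} {α : T ≫ F ⟶ F ≫ T'}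
    {β : T ≫ G ⟶ G ≫ T'} (γ : T' ≫ H ⟶ H ≫ T'') {φ : F ⟶ G}
    (h : α ≫ φ ▷ T' = T ◁ φ ≫ β) :
    compLaw α γ ≫ (φ ▷ H) ▷ T'' = T ◁ (φ ▷ H) ≫ compLaw β γ := by
  calc _ = (α_ _ _ _).inv ≫ α ▷ H ≫ (α_ _ _ _).hom ≫
        (F ◁ γ ≫ φ ▷ (H ≫ T'')) ≫ (α_ _ _ _).inv := by simp [compLaw]
    _ = (α_ _ _ _).inv ≫ (α ≫ φ ▷ T') ▷ H ≫ (α_ _ _ _).hom ≫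
        G ◁ γ ≫ (α_ _ _ _).inv := by rw [whisker_exchange]; simp
    _ = _ := by rw [h]; simp [compLaw]

theorem compLaw_assoc {F : X ⟶ Y} {G : Y ⟶ Z} {H : Z ⟶ W} (α : T ≫ F ⟶ F ≫ T')
    (β : T' ≫ G ⟶ G ≫ T'') (γ : T'' ≫ H ⟶ H ≫ T₃) :
    compLaw (compLaw α β) γ ≫ (α_ F G H).hom ▷ T₃ =
      T ◁ (α_ F G H).hom ≫ compLaw α (compLaw β γ) := by
  simp [compLaw]

theorem idLaw_compLaw {F : X ⟶ Y} (α : T ≫ F ⟶ F ≫ T') :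
    compLaw (idLaw T) α ≫ (λ_ F).hom ▷ T' = T ◁ (λ_ F).hom ≫ α := by
  simp [compLaw, idLaw]

theorem compLaw_idLaw {F : X ⟶ Y} (α : T ≫ F ⟶ F ≫ T') :
    compLaw α (idLaw T') ≫ (ρ_ F).hom ▷ T' = T ◁ (ρ_ F).hom ≫ α := by
  simp [compLaw, idLaw]

end CompLaw

namespace Tng

variable {A B C D : Tng K}

/-- The identity tangent `1`-morphism. -/
@[simps]
def Hom.id (A : Tng K) : Hom A A := ⟨𝟙 A.obj, idLaw A.str.T, isLaxLaw_id A.str⟩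

/-- Composition of lax tangent `1`-morphisms. -/
@[simps]
def Hom.comp (F : Hom A B) (G : Hom B C) : Hom A C :=
  ⟨F.hom ≫ G.hom, compLaw F.law G.law, isLaxLaw_comp F.isLaxLaw G.isLaxLaw⟩

/-- Tangent `2`-morphisms compose vertically. -/
@[simps]
instance : Category (Hom A B) where
  Hom F G := Hom₂ F G
  id F := ⟨𝟙 F.hom, by simp⟩
  comp φ ψ := ⟨φ.hom ≫ ψ.hom, by
    rw [comp_whiskerRight, ← Category.assoc, φ.comm, Category.assoc, ψ.comm,
      Bicategory.whiskerLeft_comp, Category.assoc]⟩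

@[ext]
theorem hom₂_ext {F G : Hom A B} {φ ψ : F ⟶ G} (h : φ.hom = ψ.hom) : φ = ψ := Hom₂.ext h

/-- An invertible tangent `2`-morphism from an invertible `2`-morphism. -/
@[simps]
def isoMk {F G : Hom A B} (e : F.hom ≅ G.hom)
    (h : F.law ≫ e.hom ▷ B.str.T = A.str.T ◁ e.hom ≫ G.law) : F ≅ G where
  hom := ⟨e.hom, h⟩
  inv := ⟨e.inv, by
    rw [← cancel_epi (A.str.T ◁ e.hom), ← Category.assoc, ← h]; simp⟩

/-- Left whiskering of tangent `2`-morphisms. -/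
@[simps]
def whiskerLeft (F : Hom A B) {G H : Hom B C} (φ : G ⟶ H) : F.comp G ⟶ F.comp H :=
  ⟨F.hom ◁ φ.hom, compLaw_whiskerLeft F.law φ.comm⟩

/-- Right whiskering of tangent `2`-morphisms. -/
@[simps]
def whiskerRight {F G : Hom A B} (φ : F ⟶ G) (H : Hom B C) : F.comp H ⟶ G.comp H :=
  ⟨φ.hom ▷ H.hom, compLaw_whiskerRight H.law φ.comm⟩

/-- The `2`-category of tangentads, lax tangent `1`-morphisms and tangent `2`-morphisms. -/
instance : Bicategory (Tng K) where
  Hom := Hom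
  id := Hom.id
  comp := Hom.comp
  homCategory _ _ := inferInstance
  whiskerLeft := whiskerLeft
  whiskerRight := whiskerRight
  associator F G H := isoMk (α_ F.hom G.hom H.hom) (compLaw_assoc F.law G.law H.law)
  leftUnitor F := isoMk (λ_ F.hom) (idLaw_compLaw F.law)
  rightUnitor F := isoMk (ρ_ F.hom) (compLaw_idLaw F.law)
  id_whiskerLeft φ := hom₂_ext (id_whiskerLeft φ.hom)
  comp_whiskerLeft F G _ _ φ := hom₂_ext (comp_whiskerLeft F.hom G.hom φ.hom)
  whiskerRight_id φ := hom₂_ext (whiskerRight_id φ.hom)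
  whiskerRight_comp φ G H := hom₂_ext (whiskerRight_comp φ.hom G.hom H.hom)
  whisker_assoc F _ _ φ H := hom₂_ext (whisker_assoc F.hom φ.hom H.hom)
  whisker_exchange φ ψ := hom₂_ext (whisker_exchange φ.hom ψ.hom)
  pentagon F G H I := hom₂_ext (pentagon F.hom G.hom H.hom I.hom)
  triangle F G := hom₂_ext (triangle F.hom G.hom)

theorem hom_eq {F G : A ⟶ B} (h : F.hom = G.hom)
    (h' : F.law ≫ eqToHom h ▷ B.str.T = A.str.T ◁ eqToHom h ≫ G.law) : F = G := by
  obtain ⟨F, α, _⟩ := F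
  obtain ⟨G, β, _⟩ := G
  obtain rfl : F = G := h
  obtain rfl : α = β := by simpa using h'
  rfl

theorem eqToHom_hom {F G : A ⟶ B} (h : F = G) :
    Hom₂.hom (eqToHom h) = eqToHom (congrArg Hom.hom h) := by
  subst h; rfl

theorem eq_eqToIso {F G : A ⟶ B} (h : F = G) (e : F ≅ G)
    (he : e.hom.hom = eqToHom (congrArg Hom.hom h)) : e = eqToIso h :=
  Iso.ext (hom₂_ext (he.trans (eqToHom_hom h).symm))

instance [Strict K] : Strict (Tng K) where
  id_comp F := hom_eq (Strict.id_comp F.hom) (by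
    have := idLaw_compLaw F.law
    rw [Strict.leftUnitor_eqToIso] at this
    exact this)
  comp_id F := hom_eq (Strict.comp_id F.hom) (by
    have := compLaw_idLaw F.law
    rw [Strict.rightUnitor_eqToIso] at this
    exact this)
  assoc F G H := hom_eq (Strict.assoc F.hom G.hom H.hom) (by
    have := compLaw_assoc F.law G.law H.law
    rw [Strict.associator_eqToIso] at this
    exact this)
  leftUnitor_eqToIso F :=
    eq_eqToIso _ _ (congrArg Iso.hom (Strict.leftUnitor_eqToIso F.hom))
  rightUnitor_eqToIso F :=
    eq_eqToIso _ _ (congrArg Iso.hom (Strict.rightUnitor_eqToIso F.hom))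
  associator_eqToIso F G H :=
    eq_eqToIso _ _ (congrArg Iso.hom (Strict.associator_eqToIso F.hom G.hom H.hom))

end Tng

end Tangentads

section Monads

variable {K : Type u} [Bicategory.{w, v} K]

variable (K) in
/-- A monad of `K`: an object with a monad on it. -/
structure Mnd where
  obj : K
  S : obj ⟶ obj
  η : 𝟙 obj ⟶ S
  μ : S ≫ S ⟶ S
  unit_left : η ▷ S ≫ μ = (λ_ S).hom
  unit_right : S ◁ η ≫ μ = (ρ_ S).hom
  assoc : μ ▷ S ≫ μ = (α_ S S S).hom ≫ S ◁ μ ≫ μ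

namespace Mnd

/-- Morphisms of monads `(X, S) ⟶ (X', S')`: a `1`-morphism `F` with a compatible `2`-morphism
`S' ∘ F ⟶ F ∘ S`. -/
structure Hom (A B : Mnd K) where
  hom : A.obj ⟶ B.obj
  law : hom ≫ B.S ⟶ A.S ≫ hom
  unit : hom ◁ B.η ≫ law = (ρ_ hom).hom ≫ (λ_ hom).inv ≫ A.η ▷ hom
  mul : hom ◁ B.μ ≫ law =
    (α_ hom B.S B.S).inv ≫ law ▷ B.S ≫ (α_ A.S hom B.S).hom ≫ A.S ◁ law ≫
      (α_ A.S A.S hom).inv ≫ A.μ ▷ hom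

/-- `2`-morphisms of monads. -/
@[ext]
structure Hom₂ {A B : Mnd K} (F G : Hom A B) where
  hom : F.hom ⟶ G.hom
  comm : F.law ≫ A.S ◁ hom = hom ▷ B.S ≫ G.law

section Law

variable {X Y Z W : K} {S : X ⟶ X} {S' : Y ⟶ Y} {S'' : Z ⟶ Z} {S₃ : W ⟶ W}

/-- The distributive law of a composite. -/
def compLaw {F : X ⟶ Y} {G : Y ⟶ Z} (α : F ≫ S' ⟶ S ≫ F) (β : G ≫ S'' ⟶ S' ≫ G) :
    (F ≫ G) ≫ S'' ⟶ S ≫ F ≫ G :=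
  (α_ F G S'').hom ≫ F ◁ β ≫ (α_ F S' G).inv ≫ α ▷ G ≫ (α_ S F G).hom

/-- The distributive law of an identity. -/
def idLaw (S : X ⟶ X) : 𝟙 X ≫ S ⟶ S ≫ 𝟙 X := (λ_ S).hom ≫ (ρ_ S).inv

theorem compLaw_whiskerLeft {F : X ⟶ Y} {G H : Y ⟶ Z} (α : F ≫ S' ⟶ S ≫ F)
    {β : G ≫ S'' ⟶ S' ≫ G} {γ : H ≫ S'' ⟶ S' ≫ H} {φ : G ⟶ H}
    (h : β ≫ S' ◁ φ = φ ▷ S'' ≫ γ) :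
    compLaw α β ≫ S ◁ (F ◁ φ) = (F ◁ φ) ▷ S'' ≫ compLaw α γ := by
  calc _ = (α_ F G S'').hom ≫ F ◁ β ≫ (α_ F S' G).inv ≫ (α ▷ G ≫ (S ≫ F) ◁ φ) ≫
        (α_ S F H).hom := by simp [compLaw]
    _ = (α_ F G S'').hom ≫ F ◁ (β ≫ S' ◁ φ) ≫ (α_ F S' H).inv ≫ α ▷ H ≫
        (α_ S F H).hom := by rw [← whisker_exchange]; simp
    _ = _ := by rw [h]; simp [compLaw]

theorem compLaw_whiskerRight {F G : X ⟶ Y} {H : Y ⟶ Z} {α : F ≫ S' ⟶ S ≫ F}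
    {β : G ≫ S' ⟶ S ≫ G} (γ : H ≫ S'' ⟶ S' ≫ H) {φ : F ⟶ G}
    (h : α ≫ S ◁ φ = φ ▷ S' ≫ β) :
    compLaw α γ ≫ S ◁ (φ ▷ H) = (φ ▷ H) ▷ S'' ≫ compLaw β γ := by
  calc _ = (α_ F H S'').hom ≫ F ◁ γ ≫ (α_ F S' H).inv ≫ (α ≫ S ◁ φ) ▷ H ≫
        (α_ S G H).hom := by simp [compLaw]
    _ = (α_ F H S'').hom ≫ (F ◁ γ ≫ φ ▷ (S' ≫ H)) ≫ (α_ G S' H).inv ≫ β ▷ H ≫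
        (α_ S G H).hom := by rw [h]; simp
    _ = _ := by rw [whisker_exchange]; simp [compLaw]

theorem compLaw_assoc {F : X ⟶ Y} {G : Y ⟶ Z} {H : Z ⟶ W} (α : F ≫ S' ⟶ S ≫ F)
    (β : G ≫ S'' ⟶ S' ≫ G) (γ : H ≫ S₃ ⟶ S'' ≫ H) :
    compLaw (compLaw α β) γ ≫ S ◁ (α_ F G H).hom =
      (α_ F G H).hom ▷ S₃ ≫ compLaw α (compLaw β γ) := by
  simp [compLaw]

theorem idLaw_compLaw {F : X ⟶ Y} (α : F ≫ S' ⟶ S ≫ F) :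
    compLaw (idLaw S) α ≫ S ◁ (λ_ F).hom = (λ_ F).hom ▷ S' ≫ α := by
  simp [compLaw, idLaw]

theorem compLaw_idLaw {F : X ⟶ Y} (α : F ≫ S' ⟶ S ≫ F) :
    compLaw α (idLaw S') ≫ S ◁ (ρ_ F).hom = (ρ_ F).hom ▷ S' ≫ α := by
  simp [compLaw, idLaw]

end Law

variable {A B C D : Mnd K}

/-- The identity morphism of a monad. -/
@[simps]
def Hom.id (A : Mnd K) : Hom A A where
  hom := 𝟙 A.obj
  law := idLaw A.S
  unit := by simp [idLaw, unitors_equal]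
  mul := by simp [idLaw]

/-- Composition of morphisms of monads. -/
@[simps]
def Hom.comp (F : Hom A B) (G : Hom B C) : Hom A C where
  hom := F.hom ≫ G.hom
  law := compLaw F.law G.law
  unit := by
    calc _ = (α_ _ _ _).hom ≫ F.hom ◁ (G.hom ◁ C.η ≫ G.law) ≫ (α_ _ _ _).inv ≫
          F.law ▷ G.hom ≫ (α_ _ _ _).hom := by simp [compLaw]
      _ = 𝟙 _ ⊗≫ (F.hom ◁ B.η ≫ F.law) ▷ G.hom ⊗≫ 𝟙 _ := by rw [G.unit]; bicategory
      _ = _ := by rw [F.unit]; bicategory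
  mul := by
    calc _ = 𝟙 _ ⊗≫ F.hom ◁ (G.hom ◁ C.μ ≫ G.law) ⊗≫ F.law ▷ G.hom ⊗≫ 𝟙 _ := by
          simp only [compLaw]; bicategory
      _ = 𝟙 _ ⊗≫ F.hom ◁ G.law ▷ C.S ⊗≫ F.hom ◁ B.S ◁ G.law ⊗≫
          (F.hom ◁ B.μ ≫ F.law) ▷ G.hom ⊗≫ 𝟙 _ := by rw [G.mul]; bicategory
      _ = 𝟙 _ ⊗≫ F.hom ◁ G.law ▷ C.S ⊗≫
          ((F.hom ≫ B.S) ◁ G.law ≫ F.law ▷ (B.S ≫ G.hom)) ⊗≫ A.S ◁ F.law ▷ G.hom ⊗≫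
          A.μ ▷ F.hom ▷ G.hom ⊗≫ 𝟙 _ := by rw [F.mul]; bicategory
      _ = _ := by rw [whisker_exchange]; simp only [compLaw]; bicategory

/-- `2`-morphisms of monads compose vertically. -/
@[simps]
instance : Category (Hom A B) where
  Hom F G := Hom₂ F G
  id F := ⟨𝟙 F.hom, by simp⟩
  comp φ ψ := ⟨φ.hom ≫ ψ.hom, by
    rw [comp_whiskerRight, Category.assoc, ← ψ.comm, ← Category.assoc (φ.hom ▷ B.S), ← φ.comm,
      Bicategory.whiskerLeft_comp, Category.assoc]⟩

@[ext]
theorem hom₂_ext {F G : Hom A B} {φ ψ : F ⟶ G} (h : φ.hom = ψ.hom) : φ = ψ := Hom₂.ext h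

/-- An invertible `2`-morphism of monads from an invertible `2`-morphism. -/
@[simps]
def isoMk {F G : Hom A B} (e : F.hom ≅ G.hom)
    (h : F.law ≫ A.S ◁ e.hom = e.hom ▷ B.S ≫ G.law) : F ≅ G where
  hom := ⟨e.hom, h⟩
  inv := ⟨e.inv, by
    rw [← cancel_epi (e.hom ▷ B.S), ← Category.assoc, ← h]; simp⟩

/-- Left whiskering of `2`-morphisms of monads. -/
@[simps]
def whiskerLeft (F : Hom A B) {G H : Hom B C} (φ : G ⟶ H) : F.comp G ⟶ F.comp H :=
  ⟨F.hom ◁ φ.hom, compLaw_whiskerLeft F.law φ.comm⟩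

/-- Right whiskering of `2`-morphisms of monads. -/
@[simps]
def whiskerRight {F G : Hom A B} (φ : F ⟶ G) (H : Hom B C) : F.comp H ⟶ G.comp H :=
  ⟨φ.hom ▷ H.hom, compLaw_whiskerRight H.law φ.comm⟩

/-- The `2`-category of monads. -/
instance : Bicategory (Mnd K) where
  Hom := Hom
  id := Hom.id
  comp := Hom.comp
  homCategory _ _ := inferInstance
  whiskerLeft := whiskerLeft
  whiskerRight := whiskerRight
  associator F G H := isoMk (α_ F.hom G.hom H.hom) (compLaw_assoc F.law G.law H.law)
  leftUnitor F := isoMk (λ_ F.hom) (idLaw_compLaw F.law)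
  rightUnitor F := isoMk (ρ_ F.hom) (compLaw_idLaw F.law)
  id_whiskerLeft φ := hom₂_ext (id_whiskerLeft φ.hom)
  comp_whiskerLeft F G _ _ φ := hom₂_ext (comp_whiskerLeft F.hom G.hom φ.hom)
  whiskerRight_id φ := hom₂_ext (whiskerRight_id φ.hom)
  whiskerRight_comp φ G H := hom₂_ext (whiskerRight_comp φ.hom G.hom H.hom)
  whisker_assoc F _ _ φ H := hom₂_ext (whisker_assoc F.hom φ.hom H.hom)
  whisker_exchange φ ψ := hom₂_ext (whisker_exchange φ.hom ψ.hom)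
  pentagon F G H I := hom₂_ext (pentagon F.hom G.hom H.hom I.hom)
  triangle F G := hom₂_ext (triangle F.hom G.hom)

theorem hom_eq {F G : A ⟶ B} (h : F.hom = G.hom)
    (h' : F.law ≫ A.S ◁ eqToHom h = eqToHom h ▷ B.S ≫ G.law) : F = G := by
  obtain ⟨F, α, _, _⟩ := F
  obtain ⟨G, β, _, _⟩ := G
  obtain rfl : F = G := h
  obtain rfl : α = β := by simpa using h'
  rfl

theorem eqToHom_hom {F G : A ⟶ B} (h : F = G) :
    Hom₂.hom (eqToHom h) = eqToHom (congrArg Hom.hom h) := by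
  subst h; rfl

theorem eq_eqToIso {F G : A ⟶ B} (h : F = G) (e : F ≅ G)
    (he : e.hom.hom = eqToHom (congrArg Hom.hom h)) : e = eqToIso h :=
  Iso.ext (hom₂_ext (he.trans (eqToHom_hom h).symm))

instance [Strict K] : Strict (Mnd K) where
  id_comp F := hom_eq (Strict.id_comp F.hom) (by
    have := idLaw_compLaw F.law
    rw [Strict.leftUnitor_eqToIso] at this
    exact this)
  comp_id F := hom_eq (Strict.comp_id F.hom) (by
    have := compLaw_idLaw F.law
    rw [Strict.rightUnitor_eqToIso] at this
    exact this)
  assoc F G H := hom_eq (Strict.assoc F.hom G.hom H.hom) (by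
    have := compLaw_assoc F.law G.law H.law
    rw [Strict.associator_eqToIso] at this
    exact this)
  leftUnitor_eqToIso F :=
    eq_eqToIso _ _ (congrArg Iso.hom (Strict.leftUnitor_eqToIso F.hom))
  rightUnitor_eqToIso F :=
    eq_eqToIso _ _ (congrArg Iso.hom (Strict.rightUnitor_eqToIso F.hom))
  associator_eqToIso F G H :=
    eq_eqToIso _ _ (congrArg Iso.hom (Strict.associator_eqToIso F.hom G.hom H.hom))

theorem eq_conj_eqToHom {F F' G G' : A ⟶ B} (h : F = G) (h' : G' = F') (ψ : F ⟶ F') (φ : G ⟶ G')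
    (hψ : ψ.hom = eqToHom (congrArg Hom.hom h) ≫ φ.hom ≫ eqToHom (congrArg Hom.hom h')) :
    ψ = eqToHom h ≫ φ ≫ eqToHom h' := by
  subst h h'
  apply hom₂_ext
  simpa using hψ

/-- The trivial monad on an object. -/
@[simps]
def trivial (X : K) : Mnd K where
  obj := X
  S := 𝟙 X
  η := 𝟙 (𝟙 X)
  μ := (λ_ (𝟙 X)).hom
  unit_left := by simp
  unit_right := by simp [unitors_equal]
  assoc := by simp [unitors_equal]

/-- The canonical comparison `id ∘ F ⟶ F ∘ id` (an identity in a strict `2`-category). -/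
def unitLaw {X Y : K} (F : X ⟶ Y) : F ≫ 𝟙 Y ⟶ 𝟙 X ≫ F := (ρ_ F).hom ≫ (λ_ F).inv

theorem unitLaw_unit {X Y : K} (F : X ⟶ Y) :
    F ◁ 𝟙 (𝟙 Y) ≫ unitLaw F = (ρ_ F).hom ≫ (λ_ F).inv ≫ 𝟙 (𝟙 X) ▷ F := by
  simp [unitLaw]

theorem unitLaw_mul {X Y : K} (F : X ⟶ Y) :
    F ◁ (λ_ (𝟙 Y)).hom ≫ unitLaw F =
      (α_ F (𝟙 Y) (𝟙 Y)).inv ≫ unitLaw F ▷ 𝟙 Y ≫ (α_ (𝟙 X) F (𝟙 Y)).hom ≫ 𝟙 X ◁ unitLaw F ≫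
        (α_ (𝟙 X) (𝟙 X) F).inv ≫ (λ_ (𝟙 X)).hom ▷ F := by
  simp [unitLaw, unitors_equal]

theorem unitLaw_naturality {X Y : K} {F G : X ⟶ Y} (φ : F ⟶ G) :
    unitLaw F ≫ 𝟙 X ◁ φ = φ ▷ 𝟙 Y ≫ unitLaw G := by
  simp [unitLaw]

/-- A `1`-morphism as a morphism between trivial monads. -/
@[simps]
def trivialMap {X Y : K} (F : X ⟶ Y) : Hom (trivial X) (trivial Y) where
  hom := F
  law := unitLaw F
  unit := unitLaw_unit F
  mul := unitLaw_mul F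

/-- A `2`-morphism as a `2`-morphism between morphisms of trivial monads. -/
@[simps]
def trivialMap₂ {X Y : K} {F G : X ⟶ Y} (φ : F ⟶ G) : trivialMap F ⟶ trivialMap G where
  hom := φ
  comm := unitLaw_naturality φ

theorem trivialMap_id (X : K) : trivialMap (𝟙 X) = 𝟙 (trivial X) :=
  hom_eq rfl (by
    change unitLaw (𝟙 X) ≫ 𝟙 X ◁ 𝟙 (𝟙 X) = 𝟙 (𝟙 X) ▷ 𝟙 X ≫ idLaw (𝟙 X)
    simp [unitLaw, idLaw, unitors_equal])

theorem trivialMap_comp {X Y Z : K} (F : X ⟶ Y) (G : Y ⟶ Z) :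
    trivialMap (F ≫ G) = (trivialMap F).comp (trivialMap G) :=
  hom_eq rfl (by
    change unitLaw (F ≫ G) ≫ 𝟙 X ◁ 𝟙 (F ≫ G) =
      𝟙 (F ≫ G) ▷ 𝟙 Z ≫ compLaw (unitLaw F) (unitLaw G)
    simp [unitLaw, compLaw])

variable (K) in
/-- The inclusion `2`-functor `K ⥤ Mnd K`, sending an object to its trivial monad. -/
def inc [Strict K] : StrictPseudofunctor K (Mnd K) :=
  StrictPseudofunctor.mk''
    { obj := trivial
      map := trivialMap
      map₂ := trivialMap₂
      map₂_id := fun _ ↦ rfl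
      map₂_comp := fun _ _ ↦ rfl
      map_id := trivialMap_id
      map_comp := trivialMap_comp
      map₂_whisker_left := fun _ _ _ _ ↦ eq_conj_eqToHom _ _ _ _
        ((Category.id_comp _).trans (Category.comp_id _)).symm
      map₂_whisker_right := fun _ _ ↦ eq_conj_eqToHom _ _ _ _
        ((Category.id_comp _).trans (Category.comp_id _)).symm }

end Mnd

end Monads

section TwoAdjunctions

variable {B : Type u₁} [Bicategory.{w₁, v₁} B] {C : Type u₂} [Bicategory.{w₂, v₂} C]

/-- `2`-natural transformations between `2`-functors. -/
structure TwoNatTrans (F G : StrictPseudofunctor B C) where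
  app (X : B) : F.obj X ⟶ G.obj X
  naturality {X Y : B} (f : X ⟶ Y) : F.map f ≫ app Y = app X ≫ G.map f
  naturality₂ {X Y : B} {f g : X ⟶ Y} (φ : f ⟶ g) :
    F.map₂ φ ▷ app Y ≫ eqToHom (naturality g) = eqToHom (naturality f) ≫ app X ◁ G.map₂ φ

/-- A right `2`-adjoint of a `2`-functor: a `2`-functor in the other direction with `2`-natural
unit and counit satisfying the triangle identities. -/
structure RightTwoAdjoint (F : StrictPseudofunctor B C) where
  right : StrictPseudofunctor C B
  unit : TwoNatTrans (StrictPseudofunctor.id B) (F.comp right)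
  counit : TwoNatTrans (right.comp F) (StrictPseudofunctor.id C)
  left_triangle (X : B) : F.map (unit.app X) ≫ counit.app (F.obj X) = 𝟙 (F.obj X)
  right_triangle (Y : C) : unit.app (right.obj Y) ≫ right.map (counit.app Y) = 𝟙 (right.obj Y)

end TwoAdjunctions

section Algebras

/-- A construction of algebras for `K`: a right `2`-adjoint `Alg` of the inclusion
`K ⥤ Mnd K`. -/
abbrev AlgebraConstruction (K : Type u) [Bicategory.{w, v} K] [Strict K] :=
  RightTwoAdjoint (Mnd.inc K)

/-- `K` admits the construction of algebras. -/
def AdmitsAlgebras (K : Type u) [Bicategory.{w, v} K] [Strict K] : Prop :=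
  Nonempty (AlgebraConstruction K)

variable {K : Type u} [Bicategory.{w, v} K]

/-- The Eilenberg-Moore object of a monad, for a given construction of algebras. -/
abbrev RightTwoAdjoint.alg [Strict K] (A : AlgebraConstruction K) (M : Mnd K) : K :=
  A.right.obj M

/-- The component of the counit at a monad `M = (X, S)`, from the trivial monad on `Alg M` to `M`.
Its underlying `1`-morphism `Alg M ⟶ X` is the forgetful `1`-morphism. -/
abbrev RightTwoAdjoint.forget [Strict K] (A : AlgebraConstruction K) (M : Mnd K) :
    Mnd.trivial (A.alg M) ⟶ M :=
  A.counit.app M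

/-- A tangent monad of `K` is a monad in the `2`-category of tangentads of `K`; this is its
underlying monad in `K`. -/
def Mnd.underlying (M : Mnd (Tng K)) : Mnd K where
  obj := M.obj.obj
  S := M.S.hom
  η := M.η.hom
  μ := M.μ.hom
  unit_left := congrArg Tng.Hom₂.hom M.unit_left
  unit_right := congrArg Tng.Hom₂.hom M.unit_right
  assoc := congrArg Tng.Hom₂.hom M.assoc

/-- The morphism of monads underlying a morphism of tangent monads. -/
def Mnd.underlyingHom {M N : Mnd (Tng K)} (F : M ⟶ N) : M.underlying ⟶ N.underlying where
  hom := F.hom.hom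
  law := F.law.hom
  unit := congrArg Tng.Hom₂.hom F.unit
  mul := congrArg Tng.Hom₂.hom F.mul

end Algebras

end Tangent

/-! A right `2`-adjoint amounts to a choice, for every object of the target, of a `2`-universal
arrow into it (`isUniversal_counitApp`, `IsUniversal.rightTwoAdjoint`). So it suffices to treat one
tangent monad at a time: a `2`-universal arrow `κ = (U, ψ)` from `Inc E` to the underlying monad
`(X, S)` has to be upgraded to one in `Tng K`, over the same `E` and `κ`.

Universality of `κ` says that `1`-morphisms into `E` are `S`-algebras in `X`, and `2`-morphisms are
those compatible with the actions. Two consequences drive everything. Postcomposition with `U` is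
faithful and reflects pullbacks (`IsFullyFaithfulOnAlgebras.isReflecting`). Endomorphisms of the
monad `(X, S)` lift strictly along `U` (`IsUniversal.liftsMonadLaws`), and `2`-morphisms between
them lift too (`IsAlgebraLaw.exists_isLift`).

The lax law `α` of the tangent monad, read from the other side, makes `T` an endomorphism of the
monad `S`. The pullbacks `T_n` inherit such a law because they are pointwise, and laxness of `α`
says that all structural `2`-morphisms are `2`-morphisms of monads. Hence the whole tangent
structure lifts to `E`; its equations hold by faithfulness and its pullbacks are reflected
(`TangentLift.tangentStructure`).

For universality, let `β` be a lax law on `G ≫ U`. That the action is a tangent `2`-morphism means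
that `β` is compatible with the actions, so `β` comes from a unique law on `G`
(`IsAlgebraLaw.exists_compLaw_eq`), which is again lax (`isLaxLaw_of_compLaw`). -/

namespace Tangent

/-! ### `n`-fold pullbacks by their universal property. -/

section NFoldPullbacks

variable {C : Type u} [Category.{v} C]

/-- Replaces the limit cone by plain existence and uniqueness, which is what gets reflected along
`U` later. The condition on the base leg is redundant when `n > 0`, and is kept so that `n = 0` is
covered. -/
theorem isNFoldPullback_iff {E B P : C} {q : E ⟶ B} {n : ℕ} {π : Fin n → (P ⟶ E)} {b : P ⟶ B} :
    IsNFoldPullback q π b ↔ (∀ i, π i ≫ q = b) ∧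
      ∀ (W : C) (f : Fin n → (W ⟶ E)) (g : W ⟶ B), (∀ i, f i ≫ q = g) →
        ∃! k : W ⟶ P, (∀ i, k ≫ π i = f i) ∧ k ≫ b = g := by
  constructor
  · rintro ⟨h, ⟨hl⟩⟩
    refine ⟨h, fun W f g hfg ↦ ⟨WidePullbackCone.IsLimit.lift hl g f hfg,
      ⟨fun i ↦ WidePullbackCone.IsLimit.lift_π hl g f hfg i,
        WidePullbackCone.IsLimit.lift_base hl g f hfg⟩, fun k hk ↦ ?_⟩⟩
    apply WidePullbackCone.IsLimit.hom_ext hl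
    · exact hk.2.trans (WidePullbackCone.IsLimit.lift_base hl g f hfg).symm
    · exact fun i ↦ (hk.1 i).trans (WidePullbackCone.IsLimit.lift_π hl g f hfg i).symm
  · rintro ⟨h, hl⟩
    choose lift hlift huniq using hl
    exact ⟨h, ⟨WidePullbackCone.IsLimit.mk _ (fun t ↦ lift _ t.π t.base t.condition)
      (fun t ↦ (hlift _ _ _ t.condition).2) (fun t ↦ (hlift _ _ _ t.condition).1)
      (fun t m hb hπ ↦ huniq _ _ _ t.condition m ⟨hπ, hb⟩)⟩⟩

namespace IsNFoldPullback

variable {E B P : C} {q : E ⟶ B} {n : ℕ} {π : Fin n → (P ⟶ E)} {b : P ⟶ B}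

theorem w (h : IsNFoldPullback q π b) (i : Fin n) : π i ≫ q = b := h.1 i

theorem exists_lift (h : IsNFoldPullback q π b) {W : C} (f : Fin n → (W ⟶ E)) (g : W ⟶ B)
    (hfg : ∀ i, f i ≫ q = g) : ∃ k : W ⟶ P, (∀ i, k ≫ π i = f i) ∧ k ≫ b = g :=
  ((isNFoldPullback_iff.1 h).2 W f g hfg).exists

theorem hom_ext (h : IsNFoldPullback q π b) {W : C} {k l : W ⟶ P}
    (hπ : ∀ i, k ≫ π i = l ≫ π i) (hb : k ≫ b = l ≫ b) : k = l :=
  ((isNFoldPullback_iff.1 h).2 W (fun i ↦ l ≫ π i) (l ≫ b)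
    (fun i ↦ by rw [Category.assoc, h.w])).unique ⟨hπ, hb⟩ ⟨fun _ ↦ rfl, rfl⟩

theorem of_iso (h : IsNFoldPullback q π b) {E' B' P' : C} {q' : E' ⟶ B'}
    {π' : Fin n → (P' ⟶ E')} {b' : P' ⟶ B'} (eE : E ≅ E') (eB : B ≅ B') (eP : P ≅ P')
    (hq : q ≫ eB.hom = eE.hom ≫ q') (hπ : ∀ i, π i ≫ eE.hom = eP.hom ≫ π' i)
    (hb : b ≫ eB.hom = eP.hom ≫ b') : IsNFoldPullback q' π' b' := by
  have hq' : q' = eE.inv ≫ q ≫ eB.hom := by rw [hq, Iso.inv_hom_id_assoc]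
  have hπ' : ∀ i, π' i = eP.inv ≫ π i ≫ eE.hom := fun i ↦ by rw [hπ, Iso.inv_hom_id_assoc]
  have hb' : b' = eP.inv ≫ b ≫ eB.hom := by rw [hb, Iso.inv_hom_id_assoc]
  refine isNFoldPullback_iff.2 ⟨fun i ↦ ?_, fun W f g hfg ↦ ?_⟩
  · simp [hq', hπ', hb', ← h.w i]
  · obtain ⟨k, hk, hkb⟩ := h.exists_lift (fun i ↦ f i ≫ eE.inv) (g ≫ eB.inv) (fun i ↦ by
      rw [← hfg i, hq']; simp)
    refine ⟨k ≫ eP.hom, ⟨fun i ↦ ?_, ?_⟩, fun l hl ↦ ?_⟩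
    · simp [hπ', reassoc_of% (hk i)]
    · simp [hb', reassoc_of% hkb]
    · rw [← Iso.comp_inv_eq]
      apply h.hom_ext
      · intro i
        rw [hk, ← hl.1 i, hπ']; simp
      · rw [hkb, ← hl.2, hb']; simp

end IsNFoldPullback

end NFoldPullbacks

/-! ### Whiskering in strict `2`-categories, up to heterogeneous equality. -/

section StrictHEq

variable {B : Type u₁} [Bicategory.{w₁, v₁} B] {C : Type u₂} [Bicategory.{w₂, v₂} C]

/-- In a strict `2`-category, `1`-morphisms that should agree are only propositionally equal.
Comparing `2`-morphisms by `HEq` lets calculations proceed without transporting `eqToHom`s; they are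
restored only when a structure is assembled. -/
theorem heq_eqToHom_comp {D : Type u} [Category.{v} D] {X X' Y : D} (h : X' = X) (f : X ⟶ Y) :
    HEq (eqToHom h ≫ f) f := by
  subst h; simp

theorem heq_comp_eqToHom {D : Type u} [Category.{v} D] {X Y Y' : D} (h : Y = Y') (f : X ⟶ Y) :
    HEq (f ≫ eqToHom h) f := by
  subst h; simp

theorem eqToHom_comp_eq_of_heq {D : Type u} [Category.{v} D] {X X' Y Y' : D} {f : X ⟶ Y}
    {g : X' ⟶ Y'} (hX : X = X') (hY : Y = Y') (h : HEq f g) :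
    f = eqToHom hX ≫ g ≫ eqToHom hY.symm := by
  subst hX hY; simpa using eq_of_heq h

theorem comp_eqToHom_eq_of_heq {D : Type u} [Category.{v} D] {X X' Y Y' : D} {f : X ⟶ Y}
    {g : X' ⟶ Y'} (hX : X = X') (hY : Y = Y') (h : HEq f g) :
    f ≫ eqToHom hY = eqToHom hX ≫ g := by
  subst hX hY; simpa using eq_of_heq h

theorem heq_comp {D : Type u} [Category.{v} D] {X X' Y Y' Z Z' : D} {f : X ⟶ Y} {g : Y ⟶ Z}
    {f' : X' ⟶ Y'} {g' : Y' ⟶ Z'} (hX : X = X') (hY : Y = Y') (hZ : Z = Z')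
    (hf : HEq f f') (hg : HEq g g') : HEq (f ≫ g) (f' ≫ g') := by
  subst hX hY hZ; rw [eq_of_heq hf, eq_of_heq hg]

theorem heq_whiskerLeft {a b c : B} {f f' : a ⟶ b} {g h g' h' : b ⟶ c} {φ : g ⟶ h} {φ' : g' ⟶ h'}
    (hf : f = f') (hg : g = g') (hh : h = h') (hφ : HEq φ φ') : HEq (f ◁ φ) (f' ◁ φ') := by
  subst hf hg hh; rw [eq_of_heq hφ]

theorem heq_whiskerRight {a b c : B} {f f' : b ⟶ c} {g h g' h' : a ⟶ b} {φ : g ⟶ h} {φ' : g' ⟶ h'}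
    (hf : f = f') (hg : g = g') (hh : h = h') (hφ : HEq φ φ') : HEq (φ ▷ f) (φ' ▷ f') := by
  subst hf hg hh; rw [eq_of_heq hφ]

theorem heq_map₂ (F : StrictPseudofunctor B C) {a b : B} {g h g' h' : a ⟶ b} {φ : g ⟶ h}
    {φ' : g' ⟶ h'} (hg : g = g') (hh : h = h') (hφ : HEq φ φ') : HEq (F.map₂ φ) (F.map₂ φ') := by
  subst hg hh; rw [eq_of_heq hφ]

theorem map₂_whiskerLeft_heq (F : StrictPseudofunctor B C) {a b c : B} (f : a ⟶ b) {g h : b ⟶ c}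
    (φ : g ⟶ h) : HEq (F.map₂ (f ◁ φ)) (F.map f ◁ F.map₂ φ) := by
  rw [F.map₂_whisker_left, F.mapComp_eq_eqToIso, F.mapComp_eq_eqToIso]
  simp only [eqToIso.hom, eqToIso.inv]
  exact (heq_eqToHom_comp _ _).trans (heq_comp_eqToHom _ _)

theorem map₂_whiskerRight_heq (F : StrictPseudofunctor B C) {a b c : B} {g h : a ⟶ b}
    (φ : g ⟶ h) (f : b ⟶ c) : HEq (F.map₂ (φ ▷ f)) (F.map₂ φ ▷ F.map f) := by
  rw [F.map₂_whisker_right, F.mapComp_eq_eqToIso, F.mapComp_eq_eqToIso]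
  simp only [eqToIso.hom, eqToIso.inv]
  exact (heq_eqToHom_comp _ _).trans (heq_comp_eqToHom _ _)

theorem TwoNatTrans.naturality₂_heq {F G : StrictPseudofunctor B C} (τ : TwoNatTrans F G) {X Y : B}
    {f g : X ⟶ Y} (φ : f ⟶ g) : HEq (F.map₂ φ ▷ τ.app Y) (τ.app X ◁ G.map₂ φ) :=
  (heq_comp_eqToHom (τ.naturality g) _).symm.trans
    ((heq_of_eq (τ.naturality₂ φ)).trans (heq_eqToHom_comp _ _))

variable [Strict B]

theorem id_whiskerLeft_heq {a b : B} {g h : a ⟶ b} (φ : g ⟶ h) : HEq (𝟙 a ◁ φ) φ := by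
  rw [id_whiskerLeft, Strict.leftUnitor_eqToIso, Strict.leftUnitor_eqToIso]
  simp only [eqToIso.hom, eqToIso.inv]
  exact (heq_eqToHom_comp _ _).trans (heq_comp_eqToHom _ _)

theorem whiskerRight_id_heq {a b : B} {g h : a ⟶ b} (φ : g ⟶ h) : HEq (φ ▷ 𝟙 b) φ := by
  rw [whiskerRight_id, Strict.rightUnitor_eqToIso, Strict.rightUnitor_eqToIso]
  simp only [eqToIso.hom, eqToIso.inv]
  exact (heq_eqToHom_comp _ _).trans (heq_comp_eqToHom _ _)

theorem comp_whiskerLeft_heq {a b c d : B} (f : a ⟶ b) (g : b ⟶ c) {h k : c ⟶ d} (φ : h ⟶ k) :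
    HEq ((f ≫ g) ◁ φ) (f ◁ (g ◁ φ)) := by
  rw [comp_whiskerLeft, Strict.associator_eqToIso, Strict.associator_eqToIso]
  simp only [eqToIso.hom, eqToIso.inv]
  exact (heq_eqToHom_comp _ _).trans (heq_comp_eqToHom _ _)

theorem whiskerRight_comp_heq {a b c d : B} {h k : a ⟶ b} (φ : h ⟶ k) (f : b ⟶ c) (g : c ⟶ d) :
    HEq (φ ▷ (f ≫ g)) (φ ▷ f ▷ g) := by
  rw [whiskerRight_comp, Strict.associator_eqToIso, Strict.associator_eqToIso]
  simp only [eqToIso.hom, eqToIso.inv]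
  exact (heq_eqToHom_comp _ _).trans (heq_comp_eqToHom _ _)

theorem whisker_assoc_heq {a b c d : B} (f : a ⟶ b) {h k : b ⟶ c} (φ : h ⟶ k) (g : c ⟶ d) :
    HEq ((f ◁ φ) ▷ g) (f ◁ (φ ▷ g)) := by
  rw [whisker_assoc, Strict.associator_eqToIso, Strict.associator_eqToIso]
  simp only [eqToIso.hom, eqToIso.inv]
  exact (heq_eqToHom_comp _ _).trans (heq_comp_eqToHom _ _)

end StrictHEq

/-! ### Right `2`-adjoints as choices of `2`-universal arrows. -/

section UniversalArrows

variable {B : Type u₁} [Bicategory.{w₁, v₁} B] {C : Type u₂} [Bicategory.{w₂, v₂} C]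

/-- `κ : F E ⟶ Y` is a `2`-universal arrow from `F` to `Y`: for every `Z`, the functor
`g ↦ F g ≫ κ` from `Z ⟶ E` to `F Z ⟶ Y` is an isomorphism of categories. -/
structure IsUniversal (F : StrictPseudofunctor B C) {E : B} {Y : C} (κ : F.obj E ⟶ Y) : Prop where
  existsUnique_hom : ∀ {Z : B} (f : F.obj Z ⟶ Y), ∃! g : Z ⟶ E, F.map g ≫ κ = f
  existsUnique_hom₂ : ∀ {Z : B} {g h : Z ⟶ E} (φ : F.map g ≫ κ ⟶ F.map h ≫ κ),
    ∃! ψ : g ⟶ h, F.map₂ ψ ▷ κ = φ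

namespace RightTwoAdjoint

variable {F : StrictPseudofunctor B C} (A : RightTwoAdjoint F)

/-- The components of the unit. -/
def unitApp (X : B) : X ⟶ A.right.obj (F.obj X) := A.unit.app X

/-- The components of the counit. -/
def counitApp (Y : C) : F.obj (A.right.obj Y) ⟶ Y := A.counit.app Y

theorem unitApp_naturality {X Y : B} (f : X ⟶ Y) :
    f ≫ A.unitApp Y = A.unitApp X ≫ A.right.map (F.map f) := A.unit.naturality f

theorem counitApp_naturality {X Y : C} (f : X ⟶ Y) :
    F.map (A.right.map f) ≫ A.counitApp Y = A.counitApp X ≫ f := A.counit.naturality f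

theorem unitApp_naturality₂ {X Y : B} {f g : X ⟶ Y} (φ : f ⟶ g) :
    HEq (φ ▷ A.unitApp Y) (A.unitApp X ◁ A.right.map₂ (F.map₂ φ)) := A.unit.naturality₂_heq φ

theorem counitApp_naturality₂ {X Y : C} {f g : X ⟶ Y} (φ : f ⟶ g) :
    HEq (F.map₂ (A.right.map₂ φ) ▷ A.counitApp Y) (A.counitApp X ◁ φ) :=
  A.counit.naturality₂_heq φ

theorem map_unitApp_counitApp (X : B) :
    F.map (A.unitApp X) ≫ A.counitApp (F.obj X) = 𝟙 (F.obj X) := A.left_triangle X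

theorem unitApp_map_counitApp (Y : C) :
    A.unitApp (A.right.obj Y) ≫ A.right.map (A.counitApp Y) = 𝟙 (A.right.obj Y) :=
  A.right_triangle Y

/-- Naturality of the unit followed by a triangle identity. With the next lemma, it shows that `f ↦
A.unitApp Z ≫ A.right.map f` inverts `g ↦ F.map g ≫ A.counitApp Y`; the two after that say the same
for `2`-morphisms. -/
theorem unit_map_map_counit [Strict B] {Z : B} {Y : C} (g : Z ⟶ A.right.obj Y) :
    A.unitApp Z ≫ A.right.map (F.map g ≫ A.counitApp Y) = g := by
  rw [A.right.map_comp, ← Strict.assoc, ← A.unitApp_naturality, Strict.assoc,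
    A.unitApp_map_counitApp, Strict.comp_id]

theorem map_unit_map_counit [Strict C] {Z : B} {Y : C} (f : F.obj Z ⟶ Y) :
    F.map (A.unitApp Z ≫ A.right.map f) ≫ A.counitApp Y = f := by
  rw [F.map_comp, Strict.assoc, A.counitApp_naturality, ← Strict.assoc,
    A.map_unitApp_counitApp, Strict.id_comp]

theorem unit_whiskerLeft_map₂_heq [Strict B] {Z : B} {Y : C} {g h : Z ⟶ A.right.obj Y}
    (ψ : g ⟶ h) :
    HEq (A.unitApp Z ◁ A.right.map₂ (F.map₂ ψ ▷ A.counitApp Y)) ψ := by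
  refine (heq_whiskerLeft rfl (A.right.map_comp _ _) (A.right.map_comp _ _)
    (map₂_whiskerRight_heq _ _ _)).trans ?_
  refine (whisker_assoc_heq _ _ _).symm.trans ?_
  refine (heq_whiskerRight rfl (A.unitApp_naturality g).symm (A.unitApp_naturality h).symm
    (A.unitApp_naturality₂ ψ).symm).trans ?_
  refine (whiskerRight_comp_heq _ _ _).symm.trans ?_
  rw [A.unitApp_map_counitApp]
  exact whiskerRight_id_heq _

theorem map₂_unit_whiskerLeft_heq [Strict C] {Z : B} {Y : C} {f f' : F.obj Z ⟶ Y} (φ : f ⟶ f') :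
    HEq (F.map₂ (A.unitApp Z ◁ A.right.map₂ φ) ▷ A.counitApp Y) φ := by
  refine (heq_whiskerRight rfl (F.map_comp _ _) (F.map_comp _ _)
    (map₂_whiskerLeft_heq _ _ _)).trans ?_
  refine (whisker_assoc_heq _ _ _).trans ?_
  refine (heq_whiskerLeft rfl (A.counitApp_naturality _) (A.counitApp_naturality _)
    (A.counitApp_naturality₂ _)).trans ?_
  refine (comp_whiskerLeft_heq _ _ _).symm.trans ?_
  rw [A.map_unitApp_counitApp]
  exact id_whiskerLeft_heq _

/-- The components of the counit of a `2`-adjunction are `2`-universal. -/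
theorem isUniversal_counitApp [Strict B] [Strict C] (Y : C) : IsUniversal F (A.counitApp Y) where
  existsUnique_hom f := ⟨A.unitApp _ ≫ A.right.map f, A.map_unit_map_counit f, by
    rintro g rfl; exact (A.unit_map_map_counit g).symm⟩
  existsUnique_hom₂ {Z g h} φ := by
    refine ⟨eqToHom (A.unit_map_map_counit g).symm ≫ (A.unitApp Z ◁ A.right.map₂ φ) ≫
      eqToHom (A.unit_map_map_counit h), ?_, ?_⟩
    · refine eq_of_heq (HEq.trans ?_ (A.map₂_unit_whiskerLeft_heq φ))
      refine heq_whiskerRight rfl (congrArg F.map (A.unit_map_map_counit g).symm)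
        (congrArg F.map (A.unit_map_map_counit h).symm) ?_
      exact heq_map₂ F (A.unit_map_map_counit g).symm (A.unit_map_map_counit h).symm
        ((heq_eqToHom_comp _ _).trans (heq_comp_eqToHom _ _))
    · rintro ψ rfl
      exact eq_of_heq ((A.unit_whiskerLeft_map₂_heq ψ).symm.trans
        ((heq_eqToHom_comp _ _).trans (heq_comp_eqToHom _ _)).symm)

end RightTwoAdjoint

namespace IsUniversal

variable [Strict B] [Strict C] {F : StrictPseudofunctor B C}

theorem hom_ext {E : B} {Y : C} {κ : F.obj E ⟶ Y} (h : IsUniversal F κ) {Z : B} {g g' : Z ⟶ E}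
    (e : F.map g ≫ κ = F.map g' ≫ κ) : g = g' :=
  (h.existsUnique_hom (F.map g' ≫ κ)).unique e rfl

theorem hom₂_ext {E : B} {Y : C} {κ : F.obj E ⟶ Y} (h : IsUniversal F κ) {Z : B} {g g' : Z ⟶ E}
    {ψ ψ' : g ⟶ g'} (e : F.map₂ ψ ▷ κ = F.map₂ ψ' ▷ κ) : ψ = ψ' :=
  (h.existsUnique_hom₂ (F.map₂ ψ' ▷ κ)).unique e rfl

theorem hom₂_heq {E : B} {Y : C} {κ : F.obj E ⟶ Y} (h : IsUniversal F κ) {Z : B}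
    {g k g' k' : Z ⟶ E} {ψ : g ⟶ k} {ψ' : g' ⟶ k'} (hg : g = g') (hk : k = k')
    (e : HEq (F.map₂ ψ ▷ κ) (F.map₂ ψ' ▷ κ)) : HEq ψ ψ' := by
  subst hg hk
  exact heq_of_eq (h.hom₂_ext (eq_of_heq e))

theorem exists_hom₂_heq {E : B} {Y : C} {κ : F.obj E ⟶ Y} (h : IsUniversal F κ) {Z : B}
    {g k : Z ⟶ E} {f f' : F.obj Z ⟶ Y} (hg : F.map g ≫ κ = f) (hk : F.map k ≫ κ = f')
    (φ : f ⟶ f') : ∃ ψ : g ⟶ k, HEq (F.map₂ ψ ▷ κ) φ := by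
  subst hg hk
  obtain ⟨ψ, hψ, -⟩ := h.existsUnique_hom₂ φ
  exact ⟨ψ, heq_of_eq hψ⟩

variable {R : C → B} {κ : ∀ Y, F.obj (R Y) ⟶ Y}

section

variable (h : ∀ Y, IsUniversal F (κ Y))

/-- The `1`-morphism induced between the sources of `2`-universal arrows. -/
noncomputable def map {Y Y' : C} (f : Y ⟶ Y') : R Y ⟶ R Y' :=
  ((h Y').existsUnique_hom (κ Y ≫ f)).choose

theorem map_fac {Y Y' : C} (f : Y ⟶ Y') : F.map (map h f) ≫ κ Y' = κ Y ≫ f :=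
  ((h Y').existsUnique_hom (κ Y ≫ f)).choose_spec.1

/-- The `2`-morphism induced between `1`-morphisms induced by `2`-universality. -/
noncomputable def map₂ {Y Y' : C} {f g : Y ⟶ Y'} (φ : f ⟶ g) : map h f ⟶ map h g :=
  ((h Y').exists_hom₂_heq (map_fac h f) (map_fac h g) (κ Y ◁ φ)).choose

theorem map₂_fac {Y Y' : C} {f g : Y ⟶ Y'} (φ : f ⟶ g) :
    HEq (F.map₂ (map₂ h φ) ▷ κ Y') (κ Y ◁ φ) :=
  ((h Y').exists_hom₂_heq (map_fac h f) (map_fac h g) (κ Y ◁ φ)).choose_spec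

theorem map_id (Y : C) : map h (𝟙 Y) = 𝟙 (R Y) :=
  (h Y).hom_ext (by rw [map_fac, F.map_id, Strict.id_comp, Strict.comp_id])

theorem map_comp {Y Y' Y'' : C} (f : Y ⟶ Y') (g : Y' ⟶ Y'') :
    map h (f ≫ g) = map h f ≫ map h g :=
  (h Y'').hom_ext (by
    rw [map_fac, F.map_comp, Strict.assoc, map_fac, ← Strict.assoc, ← Strict.assoc, map_fac])

theorem map₂_id {Y Y' : C} (f : Y ⟶ Y') : map₂ h (𝟙 f) = 𝟙 (map h f) :=
  (h Y').hom₂_ext (eq_of_heq ((map₂_fac h _).trans (by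
    rw [F.map₂_id, whiskerLeft_id, id_whiskerRight, map_fac])))

theorem map₂_comp {Y Y' : C} {f g k : Y ⟶ Y'} (φ : f ⟶ g) (ψ : g ⟶ k) :
    map₂ h (φ ≫ ψ) = map₂ h φ ≫ map₂ h ψ :=
  (h Y').hom₂_ext (eq_of_heq ((map₂_fac h _).trans (by
    rw [F.map₂_comp, Bicategory.whiskerLeft_comp, comp_whiskerRight]
    exact (heq_comp (map_fac h _) (map_fac h _) (map_fac h _) (map₂_fac h _)
      (map₂_fac h _)).symm)))

/-- By universality it is enough to compare after applying `F` and whiskering with `κ`; there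
`map_fac` and `map₂_fac` move `κ` to the left of everything. -/
theorem map₂_whiskerLeft {Y Y' Y'' : C} (f : Y ⟶ Y') {g k : Y' ⟶ Y''} (φ : g ⟶ k) :
    HEq (map₂ h (f ◁ φ)) (map h f ◁ map₂ h φ) := by
  refine (h Y'').hom₂_heq (map_comp h _ _) (map_comp h _ _) ((map₂_fac h _).trans ?_)
  refine HEq.symm ((heq_whiskerRight rfl (F.map_comp _ _) (F.map_comp _ _)
    (map₂_whiskerLeft_heq F _ _)).trans ?_)
  refine (whisker_assoc_heq _ _ _).trans ?_
  refine (heq_whiskerLeft rfl (map_fac h _) (map_fac h _) (map₂_fac h _)).trans ?_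
  refine (comp_whiskerLeft_heq _ _ _).symm.trans ?_
  rw [map_fac]
  exact comp_whiskerLeft_heq _ _ _

theorem map₂_whiskerRight {Y Y' Y'' : C} {f g : Y ⟶ Y'} (φ : f ⟶ g) (k : Y' ⟶ Y'') :
    HEq (map₂ h (φ ▷ k)) (map₂ h φ ▷ map h k) := by
  refine (h Y'').hom₂_heq (map_comp h _ _) (map_comp h _ _) ((map₂_fac h _).trans ?_)
  refine HEq.symm ((heq_whiskerRight rfl (F.map_comp _ _) (F.map_comp _ _)
    (map₂_whiskerRight_heq F _ _)).trans ?_)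
  refine (whiskerRight_comp_heq _ _ _).symm.trans ?_
  rw [map_fac]
  refine (whiskerRight_comp_heq _ _ _).trans ?_
  refine (heq_whiskerRight rfl (map_fac h _) (map_fac h _) (map₂_fac h _)).trans ?_
  exact whisker_assoc_heq _ _ _

/-- The `2`-functor determined by a choice of `2`-universal arrows. -/
noncomputable def right : StrictPseudofunctor C B :=
  StrictPseudofunctor.mk''
    { obj := R
      map := map h
      map₂ := map₂ h
      map₂_id := map₂_id h
      map₂_comp := map₂_comp h
      map_id := map_id h
      map_comp := map_comp h
      map₂_whisker_left := fun _ _ _ _ ↦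
        eqToHom_comp_eq_of_heq (map_comp h _ _) (map_comp h _ _) (map₂_whiskerLeft h _ _)
      map₂_whisker_right := fun _ _ ↦
        eqToHom_comp_eq_of_heq (map_comp h _ _) (map_comp h _ _) (map₂_whiskerRight h _ _) }

/-- The unit determined by a choice of `2`-universal arrows. -/
noncomputable def unitApp (X : B) : X ⟶ R (F.obj X) :=
  ((h (F.obj X)).existsUnique_hom (𝟙 (F.obj X))).choose

theorem unitApp_fac (X : B) : F.map (unitApp h X) ≫ κ (F.obj X) = 𝟙 (F.obj X) :=
  ((h (F.obj X)).existsUnique_hom (𝟙 (F.obj X))).choose_spec.1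

theorem unitApp_naturality {X Y : B} (f : X ⟶ Y) :
    f ≫ unitApp h Y = unitApp h X ≫ map h (F.map f) :=
  (h _).hom_ext (by
    rw [F.map_comp, F.map_comp, Strict.assoc, unitApp_fac, Strict.assoc, map_fac, ← Strict.assoc,
      unitApp_fac, Strict.id_comp, Strict.comp_id])

theorem unitApp_naturality₂ {X Y : B} {f g : X ⟶ Y} (φ : f ⟶ g) :
    HEq (φ ▷ unitApp h Y) (unitApp h X ◁ map₂ h (F.map₂ φ)) := by
  refine (h _).hom₂_heq (unitApp_naturality h _) (unitApp_naturality h _) ?_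
  -- Since `F.map (unitApp h X) ≫ κ (F.obj X)` is an identity, both sides reduce to `F.map₂ φ` after
  -- applying `F` and whiskering with `κ`.
  trans F.map₂ φ
  · refine (heq_whiskerRight rfl (F.map_comp _ _) (F.map_comp _ _)
      (map₂_whiskerRight_heq F _ _)).trans ?_
    refine (whiskerRight_comp_heq _ _ _).symm.trans ?_
    rw [unitApp_fac]
    exact whiskerRight_id_heq _
  · refine HEq.symm ((heq_whiskerRight rfl (F.map_comp _ _) (F.map_comp _ _)
      (map₂_whiskerLeft_heq F _ _)).trans ?_)
    refine (whisker_assoc_heq _ _ _).trans ?_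
    refine (heq_whiskerLeft rfl (map_fac h _) (map_fac h _) (map₂_fac h _)).trans ?_
    refine (comp_whiskerLeft_heq _ _ _).symm.trans ?_
    rw [unitApp_fac]
    exact id_whiskerLeft_heq _

/-- A choice of `2`-universal arrows determines a right `2`-adjoint. -/
noncomputable def rightTwoAdjoint : RightTwoAdjoint F where
  right := right h
  unit :=
    { app := unitApp h
      naturality := unitApp_naturality h
      naturality₂ := fun φ ↦
        comp_eqToHom_eq_of_heq (unitApp_naturality h _) (unitApp_naturality h _)
          (unitApp_naturality₂ h φ) }
  counit :=
    { app := fun Y ↦ κ Y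
      naturality := fun f ↦ map_fac h f
      naturality₂ := fun φ ↦ comp_eqToHom_eq_of_heq (map_fac h _) (map_fac h _) (map₂_fac h φ) }
  left_triangle := unitApp_fac h
  right_triangle Y := (h Y).hom_ext (by
    change F.map (unitApp h (R Y) ≫ map h (κ Y)) ≫ κ Y = _
    rw [F.map_comp, Strict.assoc, map_fac, ← Strict.assoc, unitApp_fac]
    exact congrArg (· ≫ κ Y) (F.map_id (R Y)).symm)

end

end IsUniversal

end UniversalArrows

/-! ### Lifting `2`-morphisms along `U`, and reflection of pullbacks. -/

section Lifts

variable {K : Type u} [Bicategory.{w, v} K] {E X : K} {U : E ⟶ X}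

/-- The `2`-morphism `φ` between endomorphisms of `E` lies over `φ₀` along `U`. -/
def IsLift {L L' : E ⟶ E} {N N' : X ⟶ X} (θ : L ≫ U ⟶ U ≫ N) (θ' : L' ≫ U ⟶ U ≫ N')
    (φ : L ⟶ L') (φ₀ : N ⟶ N') : Prop :=
  φ ▷ U ≫ θ' = θ ≫ U ◁ φ₀

/-- The composite of two laws along the same `1`-morphism. -/
def pasteLaw {L M : E ⟶ E} {N O : X ⟶ X} (θ : L ≫ U ⟶ U ≫ N) (κ : M ≫ U ⟶ U ≫ O) :
    (L ≫ M) ≫ U ⟶ U ≫ N ≫ O :=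
  (α_ L M U).hom ≫ L ◁ κ ≫ (α_ L U O).inv ≫ θ ▷ O ≫ (α_ U N O).hom

instance {L M : E ⟶ E} {N O : X ⟶ X} (θ : L ≫ U ⟶ U ≫ N) (κ : M ≫ U ⟶ U ≫ O) [IsIso θ]
    [IsIso κ] : IsIso (pasteLaw θ κ) := by
  unfold pasteLaw; infer_instance

instance : IsIso (unitLaw U) := by
  unfold unitLaw; infer_instance

/-- The law induced on the iterates of an endomorphism. -/
def iterLaw {L : E ⟶ E} {N : X ⟶ X} (θ : L ≫ U ⟶ U ≫ N) : ∀ m, iter L m ≫ U ⟶ U ≫ iter N m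
  | 0 => unitLaw U
  | m + 1 => pasteLaw (iterLaw θ m) θ

instance {L : E ⟶ E} {N : X ⟶ X} (θ : L ≫ U ⟶ U ≫ N) [IsIso θ] (m : ℕ) :
    IsIso (iterLaw θ m) := by
  induction m with
  | zero => exact inferInstanceAs (IsIso (unitLaw U))
  | succ m ih => exact inferInstanceAs (IsIso (pasteLaw (iterLaw θ m) θ))

namespace IsLift

variable {L L' L'' M M' : E ⟶ E} {N N' N'' O O' : X ⟶ X}
  {θ : L ≫ U ⟶ U ≫ N} {θ' : L' ≫ U ⟶ U ≫ N'} {θ'' : L'' ≫ U ⟶ U ≫ N''}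
  {κ : M ≫ U ⟶ U ≫ O} {κ' : M' ≫ U ⟶ U ≫ O'}

theorem id (θ : L ≫ U ⟶ U ≫ N) : IsLift θ θ (𝟙 L) (𝟙 N) := by simp [IsLift]

theorem comp {φ : L ⟶ L'} {φ₀ : N ⟶ N'} {ψ : L' ⟶ L''} {ψ₀ : N' ⟶ N''} (h : IsLift θ θ' φ φ₀)
    (h' : IsLift θ' θ'' ψ ψ₀) : IsLift θ θ'' (φ ≫ ψ) (φ₀ ≫ ψ₀) := by
  unfold IsLift at *
  rw [comp_whiskerRight, Category.assoc, h', reassoc_of% h, Bicategory.whiskerLeft_comp]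

theorem whiskerRight {φ : L ⟶ L'} {φ₀ : N ⟶ N'} (h : IsLift θ θ' φ φ₀) (κ : M ≫ U ⟶ U ≫ O) :
    IsLift (pasteLaw θ κ) (pasteLaw θ' κ) (φ ▷ M) (φ₀ ▷ O) := by
  unfold IsLift at *
  calc _ = (α_ _ _ _).hom ≫ (φ ▷ (M ≫ U) ≫ L' ◁ κ) ≫ (α_ _ _ _).inv ≫ θ' ▷ O ≫
        (α_ _ _ _).hom := by simp [pasteLaw]
    _ = (α_ _ _ _).hom ≫ L ◁ κ ≫ (α_ _ _ _).inv ≫ (φ ▷ U ≫ θ') ▷ O ≫ (α_ _ _ _).hom := by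
        rw [← whisker_exchange]; simp
    _ = _ := by rw [h]; simp [pasteLaw]

theorem whiskerLeft (θ : L ≫ U ⟶ U ≫ N) {ψ : M ⟶ M'} {ψ₀ : O ⟶ O'} (h : IsLift κ κ' ψ ψ₀) :
    IsLift (pasteLaw θ κ) (pasteLaw θ κ') (L ◁ ψ) (N ◁ ψ₀) := by
  unfold IsLift at *
  calc _ = (α_ _ _ _).hom ≫ L ◁ (ψ ▷ U ≫ κ') ≫ (α_ _ _ _).inv ≫ θ ▷ O' ≫
        (α_ _ _ _).hom := by simp [pasteLaw]
    _ = (α_ _ _ _).hom ≫ L ◁ κ ≫ (α_ _ _ _).inv ≫ ((L ≫ U) ◁ ψ₀ ≫ θ ▷ O') ≫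
        (α_ _ _ _).hom := by rw [h]; simp
    _ = _ := by rw [whisker_exchange]; simp [pasteLaw]

theorem associator_hom (θ : L ≫ U ⟶ U ≫ N) (θ' : L' ≫ U ⟶ U ≫ N') (θ'' : L'' ≫ U ⟶ U ≫ N'') :
    IsLift (pasteLaw (pasteLaw θ θ') θ'') (pasteLaw θ (pasteLaw θ' θ'')) (α_ L L' L'').hom
      (α_ N N' N'').hom := by
  simp [IsLift, pasteLaw]

theorem associator_inv (θ : L ≫ U ⟶ U ≫ N) (θ' : L' ≫ U ⟶ U ≫ N') (θ'' : L'' ≫ U ⟶ U ≫ N'') :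
    IsLift (pasteLaw θ (pasteLaw θ' θ'')) (pasteLaw (pasteLaw θ θ') θ'') (α_ L L' L'').inv
      (α_ N N' N'').inv := by
  simp [IsLift, pasteLaw]

theorem leftUnitor_hom (θ : L ≫ U ⟶ U ≫ N) :
    IsLift (pasteLaw (unitLaw U) θ) θ (λ_ L).hom (λ_ N).hom := by
  simp [IsLift, pasteLaw, unitLaw]

theorem leftUnitor_inv (θ : L ≫ U ⟶ U ≫ N) :
    IsLift θ (pasteLaw (unitLaw U) θ) (λ_ L).inv (λ_ N).inv := by
  simp [IsLift, pasteLaw, unitLaw]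

theorem rightUnitor_inv (θ : L ≫ U ⟶ U ≫ N) :
    IsLift θ (pasteLaw θ (unitLaw U)) (ρ_ L).inv (ρ_ N).inv := by
  simp [IsLift, pasteLaw, unitLaw]

end IsLift

/-- Postcomposition with `U` is faithful and reflects pullbacks and `n`-fold pullbacks. -/
structure IsReflecting (U : E ⟶ X) : Prop where
  whiskerRight_injective {Z : K} {G H : Z ⟶ E} {φ ψ : G ⟶ H} : φ ▷ U = ψ ▷ U → φ = ψ
  isPullback {Z : K} {P A B C : Z ⟶ E} {f : P ⟶ A} {g : P ⟶ B} {h : A ⟶ C} {i : B ⟶ C} :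
    IsPullback (f ▷ U) (g ▷ U) (h ▷ U) (i ▷ U) → IsPullback f g h i
  isNFoldPullback {Z : K} {A B P : Z ⟶ E} {q : A ⟶ B} {n : ℕ} {π : Fin n → (P ⟶ A)} {b : P ⟶ B} :
    IsNFoldPullback (q ▷ U) (fun i ↦ π i ▷ U) (b ▷ U) → IsNFoldPullback q π b

/-- A law, precomposed with a `1`-morphism. -/
noncomputable def whiskerLaw {Z : K} (G : Z ⟶ E) {L : E ⟶ E} {N : X ⟶ X} (θ : L ≫ U ⟶ U ≫ N)
    [IsIso θ] : (G ≫ L) ≫ U ≅ (G ≫ U) ≫ N :=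
  α_ G L U ≪≫ whiskerLeftIso G (asIso θ) ≪≫ (α_ G U N).symm

theorem IsLift.whiskerLaw {Z : K} (G : Z ⟶ E) {L L' : E ⟶ E} {N N' : X ⟶ X}
    {θ : L ≫ U ⟶ U ≫ N} {θ' : L' ≫ U ⟶ U ≫ N'} [IsIso θ] [IsIso θ'] {φ : L ⟶ L'} {φ₀ : N ⟶ N'}
    (h : IsLift θ θ' φ φ₀) :
    (whiskerLaw G θ).hom ≫ (G ≫ U) ◁ φ₀ = (G ◁ φ) ▷ U ≫ (whiskerLaw G θ').hom := by
  unfold IsLift at h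
  calc _ = (α_ _ _ _).hom ≫ G ◁ (θ ≫ U ◁ φ₀) ≫ (α_ _ _ _).inv := by
        simp [Tangent.whiskerLaw]
    _ = _ := by rw [← h]; simp [Tangent.whiskerLaw]

/-- Conjugation by associators. The axioms of a tangent structure bracket as `(G ◁ f) ▷ H`, whereas
lifts are whiskered as `G ◁ (f ▷ H)`. -/
theorem isPullback_whiskerLeft_whiskerRight_iff {Z Y W : K} (G : Z ⟶ Y) {P A B C : Y ⟶ X}
    {f : P ⟶ A} {g : P ⟶ B} {h : A ⟶ C} {i : B ⟶ C} (H : X ⟶ W) :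
    IsPullback ((G ◁ f) ▷ H) ((G ◁ g) ▷ H) ((G ◁ h) ▷ H) ((G ◁ i) ▷ H) ↔
      IsPullback (G ◁ f ▷ H) (G ◁ g ▷ H) (G ◁ h ▷ H) (G ◁ i ▷ H) :=
  ⟨fun p ↦ p.of_iso (α_ _ _ _) (α_ _ _ _) (α_ _ _ _) (α_ _ _ _) (by simp) (by simp) (by simp)
    (by simp), fun p ↦ p.of_iso (α_ _ _ _).symm (α_ _ _ _).symm (α_ _ _ _).symm (α_ _ _ _).symm
      (by simp) (by simp) (by simp) (by simp)⟩

theorem isNFoldPullback_whiskerLeft_whiskerRight_iff {Z Y W : K} (G : Z ⟶ Y) {P A B : Y ⟶ X}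
    {n : ℕ} {q : A ⟶ B} {π : Fin n → (P ⟶ A)} {b : P ⟶ B} (H : X ⟶ W) :
    IsNFoldPullback ((G ◁ q) ▷ H) (fun i ↦ (G ◁ π i) ▷ H) ((G ◁ b) ▷ H) ↔
      IsNFoldPullback (G ◁ q ▷ H) (fun i ↦ G ◁ π i ▷ H) (G ◁ b ▷ H) :=
  ⟨fun p ↦ p.of_iso (α_ _ _ _) (α_ _ _ _) (α_ _ _ _) (by simp) (by simp) (by simp),
    fun p ↦ p.of_iso (α_ _ _ _).symm (α_ _ _ _).symm (α_ _ _ _).symm (by simp) (by simp)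
      (by simp)⟩

theorem isPullback_whiskerRight_id_iff {Y : K} {P A B C : Y ⟶ X}
    {f : P ⟶ A} {g : P ⟶ B} {h : A ⟶ C} {i : B ⟶ C} :
    IsPullback (f ▷ 𝟙 X) (g ▷ 𝟙 X) (h ▷ 𝟙 X) (i ▷ 𝟙 X) ↔ IsPullback f g h i :=
  ⟨fun p ↦ p.of_iso (ρ_ _) (ρ_ _) (ρ_ _) (ρ_ _) (by simp) (by simp) (by simp)
    (by simp), fun p ↦ p.of_iso (ρ_ _).symm (ρ_ _).symm (ρ_ _).symm (ρ_ _).symm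
      (by simp) (by simp) (by simp) (by simp)⟩

theorem isNFoldPullback_whiskerRight_id_iff {Y : K} {P A B : Y ⟶ X}
    {n : ℕ} {q : A ⟶ B} {π : Fin n → (P ⟶ A)} {b : P ⟶ B} :
    IsNFoldPullback (q ▷ 𝟙 X) (fun i ↦ π i ▷ 𝟙 X) (b ▷ 𝟙 X) ↔ IsNFoldPullback q π b :=
  ⟨fun p ↦ p.of_iso (ρ_ _) (ρ_ _) (ρ_ _) (by simp) (by simp) (by simp),
    fun p ↦ p.of_iso (ρ_ _).symm (ρ_ _).symm (ρ_ _).symm (by simp) (by simp)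
      (by simp)⟩

namespace TangentStructure

theorem isPullback_whiskerLeft (t : TangentStructure X) {Z : K} (G : Z ⟶ X) :
    IsPullback (G ◁ t.π₁) (G ◁ t.π₂) (G ◁ t.p) (G ◁ t.p) :=
  isPullback_whiskerRight_id_iff.1 (t.isPullback Z G 0)

theorem isPullback_whiskerLeft_whiskerRight (t : TangentStructure X) {Z : K} (G : Z ⟶ X) :
    IsPullback (G ◁ t.π₁ ▷ t.T) (G ◁ t.π₂ ▷ t.T) (G ◁ t.p ▷ t.T) (G ◁ t.p ▷ t.T) := by
  -- The first iterate of `T` unfolds to `𝟙 X ≫ T`, so a unitor has to be removed.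
  have h : IsPullback ((G ◁ t.π₁) ▷ (𝟙 X ≫ t.T)) ((G ◁ t.π₂) ▷ (𝟙 X ≫ t.T))
    ((G ◁ t.p) ▷ (𝟙 X ≫ t.T)) ((G ◁ t.p) ▷ (𝟙 X ≫ t.T)) := t.isPullback Z G 1
  rw [← isPullback_whiskerLeft_whiskerRight_iff]
  refine h.of_iso (whiskerLeftIso _ (λ_ t.T)) (whiskerLeftIso _ (λ_ t.T))
    (whiskerLeftIso _ (λ_ t.T)) (whiskerLeftIso _ (λ_ t.T)) ?_ ?_ ?_ ?_ <;>
    exact (whisker_exchange _ _).symm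

end TangentStructure

end Lifts

/-! ### The tangent structure carried by data lying over a tangent structure. -/

section LiftedTangentStructure

variable {K : Type u} [Bicategory.{w, v} K] {E X : K} {U : E ⟶ X}

namespace IsReflecting

/-- As `θ'` is invertible and `▷ U` is faithful, a `2`-morphism is determined by what it lies over.
Every equational axiom on `E` is deduced in this way from its counterpart on `X`. -/
theorem lift_ext (hU : IsReflecting U) {L L' : E ⟶ E} {N N' : X ⟶ X} {θ : L ≫ U ⟶ U ≫ N}
    {θ' : L' ≫ U ⟶ U ≫ N'} [IsIso θ'] {φ ψ : L ⟶ L'} {φ₀ ψ₀ : N ⟶ N'} (h : IsLift θ θ' φ φ₀)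
    (h' : IsLift θ θ' ψ ψ₀) (e : φ₀ = ψ₀) : φ = ψ := by
  refine hU.whiskerRight_injective ((cancel_mono θ').1 ?_)
  unfold IsLift at h h'
  rw [h, h', e]

section Pullbacks

variable {P A B C : E ⟶ E} {P₀ A₀ B₀ C₀ : X ⟶ X} {θP : P ≫ U ⟶ U ≫ P₀} {θA : A ≫ U ⟶ U ≫ A₀}
  {θB : B ≫ U ⟶ U ≫ B₀} {θC : C ≫ U ⟶ U ≫ C₀} [IsIso θP] [IsIso θA] [IsIso θB] [IsIso θC]
  {a : P ⟶ A} {b : P ⟶ B} {f : A ⟶ C} {g : B ⟶ C} {a₀ : P₀ ⟶ A₀} {b₀ : P₀ ⟶ B₀} {f₀ : A₀ ⟶ C₀}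
  {g₀ : B₀ ⟶ C₀}

theorem isPullback_of_isLift (hU : IsReflecting U) (ha : IsLift θP θA a a₀)
    (hb : IsLift θP θB b b₀) (hf : IsLift θA θC f f₀) (hg : IsLift θB θC g g₀)
    (h : IsPullback (U ◁ a₀) (U ◁ b₀) (U ◁ f₀) (U ◁ g₀)) : IsPullback a b f g :=
  hU.isPullback (h.of_iso' (asIso θP) (asIso θA) (asIso θB) (asIso θC) ha.symm hb.symm hf.symm
    hg.symm)

/-- The invertible laws identify the image under `U` of the square at `G` with the square downstairs
at `G ≫ U`. Pointwiseness on `X` therefore gives pointwiseness on `E`. -/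
theorem isPullback_whiskerLeft_of_isLift (hU : IsReflecting U) (ha : IsLift θP θA a a₀)
    (hb : IsLift θP θB b b₀) (hf : IsLift θA θC f f₀) (hg : IsLift θB θC g g₀) {Z : K} (G : Z ⟶ E)
    (h : IsPullback ((G ≫ U) ◁ a₀) ((G ≫ U) ◁ b₀) ((G ≫ U) ◁ f₀) ((G ≫ U) ◁ g₀)) :
    IsPullback (G ◁ a) (G ◁ b) (G ◁ f) (G ◁ g) :=
  hU.isPullback (h.of_iso' (whiskerLaw G θP) (whiskerLaw G θA) (whiskerLaw G θB) (whiskerLaw G θC)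
    (ha.whiskerLaw G) (hb.whiskerLaw G) (hf.whiskerLaw G) (hg.whiskerLaw G))

theorem isNFoldPullback_whiskerLeft_of_isLift (hU : IsReflecting U) {n : ℕ} {π : Fin n → (P ⟶ A)}
    {π₀ : Fin n → (P₀ ⟶ A₀)} {c : P ⟶ C} {c₀ : P₀ ⟶ C₀} (hπ : ∀ i, IsLift θP θA (π i) (π₀ i))
    (hc : IsLift θP θC c c₀) (hf : IsLift θA θC f f₀) {Z : K} (G : Z ⟶ E)
    (h : IsNFoldPullback ((G ≫ U) ◁ f₀) (fun i ↦ (G ≫ U) ◁ π₀ i) ((G ≫ U) ◁ c₀)) :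
    IsNFoldPullback (G ◁ f) (fun i ↦ G ◁ π i) (G ◁ c) := by
  have e : ∀ {L L' : E ⟶ E} {N N' : X ⟶ X} {θ : L ≫ U ⟶ U ≫ N} {θ' : L' ≫ U ⟶ U ≫ N'}
      [IsIso θ] [IsIso θ'] {φ : L ⟶ L'} {φ₀ : N ⟶ N'}, IsLift θ θ' φ φ₀ →
      (G ≫ U) ◁ φ₀ ≫ (whiskerLaw G θ').symm.hom =
        (whiskerLaw G θ).symm.hom ≫ (G ◁ φ) ▷ U := fun h ↦ by
    rw [Iso.symm_hom, Iso.comp_inv_eq, Category.assoc, Iso.symm_hom, ← h.whiskerLaw G,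
      Iso.inv_hom_id_assoc]
  exact hU.isNFoldPullback (h.of_iso (whiskerLaw G θA).symm (whiskerLaw G θC).symm
    (whiskerLaw G θP).symm (e hf) (fun i ↦ e (hπ i)) (e hc))

/-- The mediating `2`-morphism exists upstairs because pullbacks are reflected. It lies over `k₀`
because that relation can be tested against `U ◁ a₀` and `U ◁ b₀`, which are jointly monic. This
supplies the induced maps into `T₂` and its whiskerings by `T`, such as `z_T × l`. -/
theorem exists_isLift_of_isPullback (hU : IsReflecting U) (ha : IsLift θP θA a a₀)
    (hb : IsLift θP θB b b₀) (hf : IsLift θA θC f f₀) (hg : IsLift θB θC g g₀)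
    (h : IsPullback (U ◁ a₀) (U ◁ b₀) (U ◁ f₀) (U ◁ g₀)) (w : a₀ ≫ f₀ = b₀ ≫ g₀) {W : E ⟶ E}
    {W₀ : X ⟶ X} {θW : W ≫ U ⟶ U ≫ W₀} (k₀ : W₀ ⟶ P₀) {x : W ⟶ A} {y : W ⟶ B} {x₀ : W₀ ⟶ A₀}
    {y₀ : W₀ ⟶ B₀} (hx : IsLift θW θA x x₀) (hy : IsLift θW θB y y₀) (hx₀ : k₀ ≫ a₀ = x₀)
    (hy₀ : k₀ ≫ b₀ = y₀) : ∃ k : W ⟶ P, k ≫ a = x ∧ k ≫ b = y ∧ IsLift θW θP k k₀ := by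
  subst hx₀ hy₀
  have hP := hU.isPullback_of_isLift ha hb hf hg h
  obtain ⟨k, rfl, rfl⟩ := hP.exists_lift x y
    (hU.lift_ext (hx.comp hf) (hy.comp hg) (by rw [Category.assoc, w, Category.assoc]))
  refine ⟨k, rfl, rfl, h.hom_ext ?_ ?_⟩
  · rw [IsLift, comp_whiskerRight, Category.assoc, ha, Bicategory.whiskerLeft_comp] at hx
    simpa using hx
  · rw [IsLift, comp_whiskerRight, Category.assoc, hb, Bicategory.whiskerLeft_comp] at hy
    simpa using hy

end Pullbacks

end IsReflecting

theorem isNFoldPullback_of_whiskerBoth {A B P : X ⟶ X} {n : ℕ} {q : A ⟶ B}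
    {π : Fin n → (P ⟶ A)} {b : P ⟶ B}
    (h : IsNFoldPullback ((whiskerBoth (𝟙 X) (𝟙 X)).map q)
      (fun i ↦ (whiskerBoth (𝟙 X) (𝟙 X)).map (π i)) ((whiskerBoth (𝟙 X) (𝟙 X)).map b)) :
    IsNFoldPullback q π b := by
  have h' : IsNFoldPullback (𝟙 X ◁ q) (fun i ↦ 𝟙 X ◁ π i) (𝟙 X ◁ b) :=
    isNFoldPullback_whiskerRight_id_iff.1 h
  exact h'.of_iso (λ_ _) (λ_ _) (λ_ _) (by simp) (by simp) (by simp)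

/-- Associativity of the sum of an additive bundle may be checked on the universal triple. -/
theorem sum_assoc_of_isNFoldPullback {C : Type u} [Category.{v} C] {q : BundleData C}
    (hq : IsPullback q.fst q.snd q.proj q.proj) (hs : q.sum ≫ q.proj = q.fst ≫ q.proj) {P : C}
    {π : Fin 3 → (P ⟶ q.total)} {b : P ⟶ q.base} (hP : IsNFoldPullback q.proj π b)
    {k k' m m' : P ⟶ q.total₂} (hk₁ : k ≫ q.fst = π 0) (hk₂ : k ≫ q.snd = π 1)
    (hk'₁ : k' ≫ q.fst = k ≫ q.sum) (hk'₂ : k' ≫ q.snd = π 2)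
    (hm₁ : m ≫ q.fst = π 1) (hm₂ : m ≫ q.snd = π 2)
    (hm'₁ : m' ≫ q.fst = π 0) (hm'₂ : m' ≫ q.snd = m ≫ q.sum)
    (h : k' ≫ q.sum = m' ≫ q.sum) {H : C} (x y z : H ⟶ q.total)
    (hxy : x ≫ q.proj = y ≫ q.proj) (hyz : y ≫ q.proj = z ≫ q.proj) :
    hq.lift (hq.lift x y hxy ≫ q.sum) z
        (by rw [Category.assoc, hs, IsPullback.lift_fst_assoc, hxy, hyz]) ≫ q.sum =
      hq.lift x (hq.lift y z hyz ≫ q.sum)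
        (by rw [Category.assoc, hs, IsPullback.lift_fst_assoc, hxy]) ≫ q.sum := by
  obtain ⟨r, hr, -⟩ := hP.exists_lift ![x, y, z] (x ≫ q.proj) (by
    intro i; fin_cases i
    · rfl
    · exact hxy.symm
    · exact (hxy.trans hyz).symm)
  have h0 : r ≫ π 0 = x := hr 0
  have h1 : r ≫ π 1 = y := hr 1
  have h2 : r ≫ π 2 = z := hr 2
  have ek : hq.lift x y hxy = r ≫ k := by
    apply hq.hom_ext <;> simp [hk₁, hk₂, h0, h1]
  have em : hq.lift y z hyz = r ≫ m := by
    apply hq.hom_ext <;> simp [hm₁, hm₂, h2, h1]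
  have e1 : hq.lift (hq.lift x y hxy ≫ q.sum) z
        (by rw [Category.assoc, hs, IsPullback.lift_fst_assoc, hxy, hyz]) = r ≫ k' := by
    apply hq.hom_ext <;> simp [hk'₁, hk'₂, h2, ek]
  have e2 : hq.lift x (hq.lift y z hyz ≫ q.sum)
        (by rw [Category.assoc, hs, IsPullback.lift_fst_assoc, hxy]) = r ≫ m' := by
    apply hq.hom_ext <;> simp [hm'₁, hm'₂, h0, em]
  rw [e1, e2, Category.assoc, Category.assoc, h]

/-- The data `d` on `E` lie over the tangent structure `t` along `U`. -/
structure TangentLift (t : TangentStructure X) (U : E ⟶ X) (d : TangentData E) where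
  law : d.T ≫ U ⟶ U ≫ t.T
  law₂ : d.T₂ ≫ U ⟶ U ≫ t.T₂
  isIso_law : IsIso law
  isIso_law₂ : IsIso law₂
  p : IsLift law (unitLaw U) d.p t.p
  π₁ : IsLift law₂ law d.π₁ t.π₁
  π₂ : IsLift law₂ law d.π₂ t.π₂
  z : IsLift (unitLaw U) law d.z t.z
  s : IsLift law₂ law d.s t.s
  l : IsLift law (pasteLaw law law) d.l t.l
  c : IsLift (pasteLaw law law) (pasteLaw law law) d.c t.c
  exists_pullback : ∀ n : ℕ, 0 < n →
    ∃ (Tn : X ⟶ X) (π : Fin n → (Tn ⟶ t.T)) (b : Tn ⟶ 𝟙 X) (Ln : E ⟶ E) (π' : Fin n → (Ln ⟶ d.T))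
      (b' : Ln ⟶ 𝟙 E) (θ : Ln ≫ U ⟶ U ≫ Tn),
      (∀ (X' : K) (G : X' ⟶ X) (m : ℕ),
        IsNFoldPullback ((whiskerBoth G (iter t.T m)).map t.p)
          (fun i ↦ (whiskerBoth G (iter t.T m)).map (π i)) ((whiskerBoth G (iter t.T m)).map b)) ∧
      IsIso θ ∧ (∀ i, IsLift θ law (π' i) (π i)) ∧ IsLift θ (unitLaw U) b' b

attribute [instance] TangentLift.isIso_law TangentLift.isIso_law₂

namespace TangentLift

variable {t : TangentStructure X} {d : TangentData E}

/-- Whiskering by the `m`-th iterate of `d.T` lies over whiskering by that of `t.T`, through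
`iterLaw`; the pullback downstairs is then used at `G ≫ U` with the same `m`. -/
theorem exists_pullback_whiskerBoth (h : TangentLift t U d) (hU : IsReflecting U) (n : ℕ)
    (hn : 0 < n) : ∃ (Tn : E ⟶ E) (π : Fin n → (Tn ⟶ d.T)) (b : Tn ⟶ 𝟙 E),
      ∀ (X' : K) (G : X' ⟶ E) (m : ℕ),
        IsNFoldPullback ((whiskerBoth G (iter d.T m)).map d.p)
          (fun i ↦ (whiskerBoth G (iter d.T m)).map (π i))
          ((whiskerBoth G (iter d.T m)).map b) := by
  obtain ⟨Tn, π, b, Ln, π', b', θ, hTn, hθ, hπ, hb⟩ := h.exists_pullback n hn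
  refine ⟨Ln, π', b', fun X' G m ↦ ?_⟩
  refine (isNFoldPullback_whiskerLeft_whiskerRight_iff G (iter d.T m)).2 ?_
  refine hU.isNFoldPullback_whiskerLeft_of_isLift
    (fun i ↦ (hπ i).whiskerRight (iterLaw h.law m)) (hb.whiskerRight _) (h.p.whiskerRight _) G ?_
  exact (isNFoldPullback_whiskerLeft_whiskerRight_iff _ _).1 (hTn X' (G ≫ U) m)

theorem isPullback_whiskerBoth (h : TangentLift t U d) (hU : IsReflecting U) (X' : K) (G : X' ⟶ E)
    (m : ℕ) : IsPullback ((whiskerBoth G (iter d.T m)).map d.π₁)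
      ((whiskerBoth G (iter d.T m)).map d.π₂)
      ((whiskerBoth G (iter d.T m)).map d.p) ((whiskerBoth G (iter d.T m)).map d.p) := by
  refine (isPullback_whiskerLeft_whiskerRight_iff G (iter d.T m)).2 ?_
  refine hU.isPullback_whiskerLeft_of_isLift (h.π₁.whiskerRight (iterLaw h.law m))
    (h.π₂.whiskerRight _) (h.p.whiskerRight _) (h.p.whiskerRight _) G ?_
  exact (isPullback_whiskerLeft_whiskerRight_iff _ _).1 (t.isPullback X' (G ≫ U) m)

theorem isPullback (h : TangentLift t U d) (hU : IsReflecting U) :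
    IsPullback d.π₁ d.π₂ d.p d.p :=
  hU.isPullback_of_isLift h.π₁ h.π₂ h.p h.p (t.isPullback_whiskerLeft U)

theorem exists_lift (h : TangentLift t U d) (hU : IsReflecting U) {W : E ⟶ E} {W₀ : X ⟶ X}
    {θ : W ≫ U ⟶ U ≫ W₀} (k₀ : W₀ ⟶ t.T₂) {x y : W ⟶ d.T} {x₀ y₀ : W₀ ⟶ t.T}
    (hx : IsLift θ h.law x x₀) (hy : IsLift θ h.law y y₀) (hx₀ : k₀ ≫ t.π₁ = x₀)
    (hy₀ : k₀ ≫ t.π₂ = y₀) :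
    ∃ k : W ⟶ d.T₂, k ≫ d.π₁ = x ∧ k ≫ d.π₂ = y ∧ IsLift θ h.law₂ k k₀ :=
  hU.exists_isLift_of_isPullback h.π₁ h.π₂ h.p h.p (t.isPullback_whiskerLeft U)
    t.additive.isPullback.w k₀ hx hy hx₀ hy₀

theorem exists_lift_whiskerRight (h : TangentLift t U d) (hU : IsReflecting U) {W : E ⟶ E}
    {W₀ : X ⟶ X} {θ : W ≫ U ⟶ U ≫ W₀} (k₀ : W₀ ⟶ t.T₂ ≫ t.T) {x y : W ⟶ d.T ≫ d.T}
    {x₀ y₀ : W₀ ⟶ t.T ≫ t.T} (hx : IsLift θ (pasteLaw h.law h.law) x x₀)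
    (hy : IsLift θ (pasteLaw h.law h.law) y y₀) (hx₀ : k₀ ≫ t.π₁ ▷ t.T = x₀)
    (hy₀ : k₀ ≫ t.π₂ ▷ t.T = y₀) :
    ∃ k : W ⟶ d.T₂ ≫ d.T, k ≫ d.π₁ ▷ d.T = x ∧ k ≫ d.π₂ ▷ d.T = y ∧
      IsLift θ (pasteLaw h.law₂ h.law) k k₀ :=
  hU.exists_isLift_of_isPullback (h.π₁.whiskerRight h.law) (h.π₂.whiskerRight h.law)
    (h.p.whiskerRight h.law) (h.p.whiskerRight h.law) (t.isPullback_whiskerLeft_whiskerRight U)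
    (by rw [← comp_whiskerRight, ← comp_whiskerRight]
        exact congrArg (· ▷ t.T) t.additive.isPullback.w) k₀ hx hy hx₀ hy₀

theorem exists_lift_whiskerLeft (h : TangentLift t U d) (hU : IsReflecting U) {W : E ⟶ E}
    {W₀ : X ⟶ X} {θ : W ≫ U ⟶ U ≫ W₀} (k₀ : W₀ ⟶ t.T ≫ t.T₂) {x y : W ⟶ d.T ≫ d.T}
    {x₀ y₀ : W₀ ⟶ t.T ≫ t.T} (hx : IsLift θ (pasteLaw h.law h.law) x x₀)
    (hy : IsLift θ (pasteLaw h.law h.law) y y₀) (hx₀ : k₀ ≫ t.T ◁ t.π₁ = x₀)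
    (hy₀ : k₀ ≫ t.T ◁ t.π₂ = y₀) :
    ∃ k : W ⟶ d.T ≫ d.T₂, k ≫ d.T ◁ d.π₁ = x ∧ k ≫ d.T ◁ d.π₂ = y ∧
      IsLift θ (pasteLaw h.law h.law₂) k k₀ :=
  hU.exists_isLift_of_isPullback (h.π₁.whiskerLeft h.law) (h.π₂.whiskerLeft h.law)
    (h.p.whiskerLeft h.law) (h.p.whiskerLeft h.law)
    ((t.isPullback_whiskerLeft (U ≫ t.T)).of_iso (α_ _ _ _) (α_ _ _ _) (α_ _ _ _) (α_ _ _ _)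
      (by simp) (by simp) (by simp) (by simp))
    (by rw [← Bicategory.whiskerLeft_comp, ← Bicategory.whiskerLeft_comp]
        exact congrArg (t.T ◁ ·) t.additive.isPullback.w) k₀ hx hy hx₀ hy₀

theorem sum_proj (h : TangentLift t U d) (hU : IsReflecting U) : d.s ≫ d.p = d.π₁ ≫ d.p :=
  hU.lift_ext (h.s.comp h.p) (h.π₁.comp h.p) t.additive.sum_proj

/-- Arbitrary `x y z` need not lie over anything, so `lift_ext` does not apply to them. The three
projections of the lifted `3`-fold pullback do lie over those of `X`, and the general case follows
from this universal triple. -/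
theorem sum_assoc (h : TangentLift t U d) (hU : IsReflecting U) {H : E ⟶ E} (x y z : H ⟶ d.T)
    (hxy : x ≫ d.p = y ≫ d.p) (hyz : y ≫ d.p = z ≫ d.p) :
    (h.isPullback hU).lift ((h.isPullback hU).lift x y hxy ≫ d.s) z
        (by rw [Category.assoc, h.sum_proj hU, IsPullback.lift_fst_assoc, hxy, hyz]) ≫ d.s =
      (h.isPullback hU).lift x ((h.isPullback hU).lift y z hyz ≫ d.s)
        (by rw [Category.assoc, h.sum_proj hU, IsPullback.lift_fst_assoc, hxy]) ≫ d.s := by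
  obtain ⟨Tn, π, b, Ln, π', b', θ, hTn, hθ, hπ, hb⟩ := h.exists_pullback 3 (by norm_num)
  have hX : IsNFoldPullback t.p π b := isNFoldPullback_of_whiskerBoth (hTn X (𝟙 X) 0)
  have hE : IsNFoldPullback d.p π' b' := by
    refine isNFoldPullback_of_whiskerBoth (X := E) ?_
    refine isNFoldPullback_whiskerRight_id_iff.2 ?_
    exact hU.isNFoldPullback_whiskerLeft_of_isLift hπ hb h.p (𝟙 E)
      (isNFoldPullback_whiskerRight_id_iff.1 (hTn E (𝟙 E ≫ U) 0))
  have w₀ : ∀ i j, π i ≫ t.p = π j ≫ t.p := fun i j ↦ (hX.w i).trans (hX.w j).symm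
  have q : IsPullback t.π₁ t.π₂ t.p t.p := t.additive.isPullback
  have hs : t.s ≫ t.p = t.π₁ ≫ t.p := t.additive.sum_proj
  obtain ⟨k, hk₁, hk₂, hk⟩ := h.exists_lift hU (q.lift (π 0) (π 1) (w₀ 0 1)) (hπ 0) (hπ 1)
    (by simp) (by simp)
  obtain ⟨m, hm₁, hm₂, hm⟩ := h.exists_lift hU (q.lift (π 1) (π 2) (w₀ 1 2)) (hπ 1) (hπ 2)
    (by simp) (by simp)
  obtain ⟨k', hk'₁, hk'₂, hk'⟩ := h.exists_lift hU
    (q.lift (q.lift (π 0) (π 1) (w₀ 0 1) ≫ t.s) (π 2)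
      (by rw [Category.assoc, hs, IsPullback.lift_fst_assoc, w₀ 0 2]))
    (hk.comp h.s) (hπ 2) (by simp) (by simp)
  obtain ⟨m', hm'₁, hm'₂, hm'⟩ := h.exists_lift hU
    (q.lift (π 0) (q.lift (π 1) (π 2) (w₀ 1 2) ≫ t.s)
      (by rw [Category.assoc, hs, IsPullback.lift_fst_assoc, w₀ 0 1]))
    (hπ 0) (hm.comp h.s) (by simp) (by simp)
  have e : k' ≫ d.s = m' ≫ d.s := hU.lift_ext (hk'.comp h.s) (hm'.comp h.s)
    (t.additive.sum_assoc (π 0) (π 1) (π 2) (w₀ 0 1) (w₀ 1 2))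
  exact sum_assoc_of_isNFoldPullback (q := d.bundle) (h.isPullback hU) (h.sum_proj hU) hE
    hk₁ hk₂ hk'₁ hk'₂ hm₁ hm₂ hm'₁ hm'₂ e x y z hxy hyz

theorem zero_proj (h : TangentLift t U d) (hU : IsReflecting U) : d.z ≫ d.p = 𝟙 (𝟙 E) :=
  hU.lift_ext (h.z.comp h.p) (IsLift.id _) t.additive.zero_proj

theorem sum_unit (h : TangentLift t U d) (hU : IsReflecting U) :
    (h.isPullback hU).lift (d.p ≫ d.z) (𝟙 d.T)
      (by rw [Category.assoc, h.zero_proj hU, Category.comp_id, Category.id_comp]) ≫ d.s =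
        𝟙 d.T := by
  have q : IsPullback t.π₁ t.π₂ t.p t.p := t.additive.isPullback
  have hz : t.z ≫ t.p = 𝟙 (𝟙 X) := t.additive.zero_proj
  obtain ⟨k, hk₁, hk₂, hk⟩ := h.exists_lift hU (q.lift (t.p ≫ t.z) (𝟙 t.T)
    (by rw [Category.assoc, hz, Category.comp_id, Category.id_comp])) (h.p.comp h.z) (.id _)
    (by simp) (by simp)
  rw [show (h.isPullback hU).lift (d.p ≫ d.z) (𝟙 d.T) _ = k from
    (h.isPullback hU).hom_ext (by simp [hk₁]) (by simp [hk₂])]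
  exact hU.lift_ext (θ' := h.law) (hk.comp h.s) (.id _) t.additive.sum_unit

theorem sum_comm (h : TangentLift t U d) (hU : IsReflecting U) :
    (h.isPullback hU).lift d.π₂ d.π₁ (h.isPullback hU).w.symm ≫ d.s = d.s := by
  have q : IsPullback t.π₁ t.π₂ t.p t.p := t.additive.isPullback
  obtain ⟨k, hk₁, hk₂, hk⟩ := h.exists_lift hU (q.lift t.π₂ t.π₁ q.w.symm) h.π₂ h.π₁
    (by simp) (by simp)
  rw [show (h.isPullback hU).lift d.π₂ d.π₁ _ = k from
    (h.isPullback hU).hom_ext (by simp [hk₁]) (by simp [hk₂])]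
  exact hU.lift_ext (θ' := h.law) (hk.comp h.s) h.s t.additive.sum_comm

theorem isAdditive (h : TangentLift t U d) (hU : IsReflecting U) : d.bundle.IsAdditive where
  exists_pullback n hn := by
    obtain ⟨Tn, π, b, hTn⟩ := h.exists_pullback_whiskerBoth hU n hn
    exact ⟨Tn, π, b, isNFoldPullback_of_whiskerBoth (hTn E (𝟙 E) 0)⟩
  isPullback := h.isPullback hU
  zero_proj := h.zero_proj hU
  sum_proj := h.sum_proj hU
  sum_assoc := h.sum_assoc hU
  sum_unit := h.sum_unit hU
  sum_comm := h.sum_comm hU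

theorem lift_additive (h : TangentLift t U d) (hU : IsReflecting U) :
    IsAdditiveHom d.bundle (d.bundle.map (postcomp E d.T)) (d.z ≫ (λ_ d.T).inv) d.l := by
  obtain ⟨hp, hz, g, hg₁, hg₂, hs⟩ := t.lift_additive
  obtain ⟨k, hk₁, hk₂, hk⟩ := h.exists_lift_whiskerRight hU g (h.π₁.comp h.l) (h.π₂.comp h.l)
    hg₁ hg₂
  have ep : d.l ≫ d.p ▷ d.T = d.p ≫ d.z ≫ (λ_ d.T).inv :=
    hU.lift_ext (h.l.comp (h.p.whiskerRight _)) (h.p.comp (h.z.comp (.leftUnitor_inv _))) hp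
  have ez : d.z ≫ d.l = (d.z ≫ (λ_ d.T).inv) ≫ d.z ▷ d.T :=
    hU.lift_ext (h.z.comp h.l) ((h.z.comp (.leftUnitor_inv _)).comp (h.z.whiskerRight _)) hz
  have es : d.s ≫ d.l = k ≫ d.s ▷ d.T :=
    hU.lift_ext (h.s.comp h.l) (hk.comp (h.s.whiskerRight _)) hs
  exact ⟨ep, ez, k, hk₁, hk₂, es⟩

theorem flip_additive (h : TangentLift t U d) (hU : IsReflecting U) :
    IsAdditiveHom (d.bundle.map (postcomp E d.T)) (d.bundle.map (precomp E d.T)) (unitLaw d.T)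
      d.c := by
  obtain ⟨hp, hz, g, hg₁, hg₂, hs⟩ := t.flip_additive
  obtain ⟨k, hk₁, hk₂, hk⟩ := h.exists_lift_whiskerLeft hU g ((h.π₁.whiskerRight _).comp h.c)
    ((h.π₂.whiskerRight _).comp h.c) hg₁ hg₂
  have hu := (IsLift.leftUnitor_hom h.law).comp (.rightUnitor_inv h.law)
  have ep : d.c ≫ d.T ◁ d.p = d.p ▷ d.T ≫ unitLaw d.T :=
    hU.lift_ext (h.c.comp (h.p.whiskerLeft _)) ((h.p.whiskerRight _).comp hu) hp
  have ez : d.z ▷ d.T ≫ d.c = unitLaw d.T ≫ d.T ◁ d.z :=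
    hU.lift_ext ((h.z.whiskerRight _).comp h.c) (hu.comp (h.z.whiskerLeft _)) hz
  have es : d.s ▷ d.T ≫ d.c = k ≫ d.T ◁ d.s :=
    hU.lift_ext ((h.s.whiskerRight _).comp h.c) (hk.comp (h.s.whiskerLeft _)) hs
  exact ⟨ep, ez, k, hk₁, hk₂, es⟩

/-- Data over a tangent structure along a reflecting `1`-morphism form a tangent structure. -/
def tangentStructure (h : TangentLift t U d) (hU : IsReflecting U) : TangentStructure E where
  toTangentData := d
  additive := h.isAdditive hU
  exists_pullback := h.exists_pullback_whiskerBoth hU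
  isPullback := h.isPullback_whiskerBoth hU
  lift_additive := h.lift_additive hU
  flip_additive := h.flip_additive hU
  lift_coassoc := hU.lift_ext (h.l.comp ((h.l.whiskerRight _).comp (.associator_hom _ _ _)))
    (h.l.comp (h.l.whiskerLeft _)) t.lift_coassoc
  lift_flip := hU.lift_ext (h.l.comp h.c) h.l t.lift_flip
  lift_flip_flip := hU.lift_ext ((h.l.whiskerLeft _).comp ((IsLift.associator_inv _ _ _).comp
      ((h.c.whiskerRight _).comp ((IsLift.associator_hom _ _ _).comp (h.c.whiskerLeft _)))))
    (h.c.comp ((h.l.whiskerRight _).comp (.associator_hom _ _ _))) t.lift_flip_flip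
  flip_flip := hU.lift_ext (h.c.comp h.c) (.id _) t.flip_flip
  flip_braid := hU.lift_ext ((h.c.whiskerRight _).comp ((IsLift.associator_hom _ _ _).comp
      ((h.c.whiskerLeft _).comp ((IsLift.associator_inv _ _ _).comp (h.c.whiskerRight _)))))
    ((IsLift.associator_hom _ _ _).comp ((h.c.whiskerLeft _).comp
      ((IsLift.associator_inv _ _ _).comp ((h.c.whiskerRight _).comp
        ((IsLift.associator_hom _ _ _).comp ((h.c.whiskerLeft _).comp
          (.associator_inv _ _ _))))))) t.flip_braid
  locally_linear := by
    -- The map `z_T × l` is lifted through the pullback `T₂ ≫ T`; the linearity square on `X` is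
    -- then used at `G ≫ U`.
    obtain ⟨ν, hν₁, hν₂, hν⟩ := t.locally_linear
    obtain ⟨k, hk₁, hk₂, hk⟩ := h.exists_lift_whiskerRight hU ν
      (h.π₁.comp ((IsLift.rightUnitor_inv _).comp (h.z.whiskerLeft _))) (h.π₂.comp h.l) hν₁ hν₂
    exact ⟨k, hk₁, hk₂, fun Z G ↦ hU.isPullback_whiskerLeft_of_isLift
      (hk.comp (h.s.whiskerRight _)) (h.π₁.comp h.p)
      ((h.p.whiskerRight _).comp (.leftUnitor_hom _)) h.z G (hν Z (G ≫ U))⟩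

end TangentLift

end LiftedTangentStructure

/-! ### What `2`-universality says about algebras: full faithfulness and reflection. -/

section Algebras

variable {K : Type u} [Bicategory.{w, v} K] {E X : K} {S : X ⟶ X} {U : E ⟶ X}

/-- The action on `g ≫ U` induced by an action `ψ` on `U`. -/
def act (ψ : U ≫ S ⟶ 𝟙 E ≫ U) {Z : K} (g : Z ⟶ E) : (g ≫ U) ≫ S ⟶ 𝟙 Z ≫ g ≫ U :=
  Mnd.compLaw (Mnd.unitLaw g) ψ

theorem act_naturality (ψ : U ≫ S ⟶ 𝟙 E ≫ U) {Z : K} {g h : Z ⟶ E} (φ : g ⟶ h) :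
    act ψ g ≫ 𝟙 Z ◁ (φ ▷ U) = (φ ▷ U) ▷ S ≫ act ψ h :=
  Mnd.compLaw_whiskerRight ψ (Mnd.unitLaw_naturality φ)

/-- Every `2`-morphism `g ≫ U ⟶ h ≫ U` compatible with the actions is uniquely of the form
`χ ▷ U`. -/
structure IsFullyFaithfulOnAlgebras (ψ : U ≫ S ⟶ 𝟙 E ≫ U) : Prop where
  existsUnique {Z : K} {g h : Z ⟶ E} (φ : g ≫ U ⟶ h ≫ U)
    (comm : act ψ g ≫ 𝟙 Z ◁ φ = φ ▷ S ≫ act ψ h) : ∃! χ : g ⟶ h, χ ▷ U = φ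

namespace IsFullyFaithfulOnAlgebras

variable {ψ : U ≫ S ⟶ 𝟙 E ≫ U}

theorem whiskerRight_injective (hψ : IsFullyFaithfulOnAlgebras ψ) {Z : K} {g h : Z ⟶ E}
    {φ χ : g ⟶ h} (e : φ ▷ U = χ ▷ U) : φ = χ :=
  (hψ.existsUnique (χ ▷ U) (act_naturality ψ χ)).unique e rfl

/-- A mediating `k` between images under `U` is automatically compatible with the actions: this can
be tested on the legs `π i ▷ U`, and both these and the composites `f i ▷ U` are compatible. Only
joint monicity of the legs is used; `S` need not preserve the limit. -/
theorem exists_whiskerRight_eq (hψ : IsFullyFaithfulOnAlgebras ψ) {Z : K} {W P : Z ⟶ E}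
    {ι : Type*} {A : ι → (Z ⟶ E)} {π : ∀ i, P ⟶ A i}
    (hπ : ∀ {V : Z ⟶ X} {u v : V ⟶ P ≫ U}, (∀ i, u ≫ π i ▷ U = v ≫ π i ▷ U) → u = v)
    (f : ∀ i, W ⟶ A i) (k : W ≫ U ⟶ P ≫ U) (hk : ∀ i, k ≫ π i ▷ U = f i ▷ U) :
    ∃ r : W ⟶ P, ∀ i, r ≫ π i = f i := by
  have comm : act ψ W ≫ 𝟙 Z ◁ k = k ▷ S ≫ act ψ P := by
    rw [← cancel_mono (λ_ _).hom]
    refine hπ fun i ↦ ?_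
    have e : ∀ {V : Z ⟶ X} (x : V ⟶ 𝟙 Z ≫ P ≫ U), (x ≫ (λ_ _).hom) ≫ π i ▷ U =
        (x ≫ 𝟙 Z ◁ (π i ▷ U)) ≫ (λ_ _).hom := fun x ↦ by simp
    rw [e, e]
    congr 1
    rw [Category.assoc, ← Bicategory.whiskerLeft_comp, hk, act_naturality, Category.assoc,
      act_naturality, ← comp_whiskerRight_assoc, hk]
  obtain ⟨r, hr, -⟩ := hψ.existsUnique k comm
  replace hr : r ▷ U = k := hr
  exact ⟨r, fun i ↦ hψ.whiskerRight_injective (by rw [comp_whiskerRight, hr, hk])⟩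

theorem isReflecting (hψ : IsFullyFaithfulOnAlgebras ψ) : IsReflecting U where
  whiskerRight_injective := hψ.whiskerRight_injective
  isPullback {Z P A B C f g h i} H := by
    refine IsPullback.mk' (hψ.whiskerRight_injective (by simpa using H.w)) ?_ ?_
    · intro T φ φ' h₁ h₂
      refine hψ.whiskerRight_injective (H.hom_ext ?_ ?_)
      · rw [← comp_whiskerRight, h₁, comp_whiskerRight]
      · rw [← comp_whiskerRight, h₂, comp_whiskerRight]
    · intro T a b hab
      have w : a ▷ U ≫ h ▷ U = b ▷ U ≫ i ▷ U := by
        rw [← comp_whiskerRight, hab, comp_whiskerRight]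
      obtain ⟨r, hr⟩ := hψ.exists_whiskerRight_eq (W := T) (P := P) (ι := Bool)
        (A := fun j ↦ bif j then A else B) (π := fun j ↦ match j with | true => f | false => g)
        (fun {V u v} huv ↦ H.hom_ext (huv true) (huv false))
        (fun j ↦ match j with | true => a | false => b) (H.lift _ _ w)
        (fun j ↦ match j with | true => H.lift_fst _ _ w | false => H.lift_snd _ _ w)
      exact ⟨r, hr true, hr false⟩
  isNFoldPullback {Z A B P q n π b} H := by
    refine isNFoldPullback_iff.2 ⟨fun i ↦ hψ.whiskerRight_injective (by simpa using H.w i), ?_⟩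
    intro W f g hfg
    obtain ⟨k, hk, hkb⟩ := H.exists_lift (fun i ↦ f i ▷ U) (g ▷ U)
      (fun i ↦ by rw [← hfg i, comp_whiskerRight])
    -- The index `none` stands for the leg to the base.
    obtain ⟨r, hr⟩ := hψ.exists_whiskerRight_eq (W := W) (P := P) (ι := Option (Fin n))
      (A := fun j ↦ match j with | some _ => A | none => B)
      (π := fun j ↦ match j with | some i => π i | none => b)
      (fun {V u v} huv ↦ H.hom_ext (fun i ↦ huv (some i)) (huv none))
      (fun j ↦ match j with | some i => f i | none => g) k
      (fun j ↦ match j with | some i => hk i | none => hkb)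
    have hr₁ : ∀ i, r ≫ π i = f i := fun i ↦ hr (some i)
    have hr₂ : r ≫ b = g := hr none
    refine ⟨r, ⟨hr₁, hr₂⟩, fun r' hr' ↦ ?_⟩
    refine hψ.whiskerRight_injective (H.hom_ext (fun i ↦ ?_) ?_)
    · rw [← comp_whiskerRight, ← comp_whiskerRight, hr'.1 i, hr₁]
    · rw [← comp_whiskerRight, ← comp_whiskerRight, hr'.2, hr₂]

end IsFullyFaithfulOnAlgebras

/-- The law `θ` is compatible with the action `ψ` on `U` and the law `n`. -/
def IsAlgebraLaw (ψ : U ≫ S ⟶ 𝟙 E ≫ U) {L : E ⟶ E} {N : X ⟶ X} (θ : L ≫ U ⟶ U ≫ N)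
    (n : N ≫ S ⟶ S ≫ N) : Prop :=
  act ψ L ≫ 𝟙 E ◁ θ = θ ▷ S ≫ Mnd.compLaw ψ n

namespace IsAlgebraLaw

variable {ψ : U ≫ S ⟶ 𝟙 E ≫ U} {L L' : E ⟶ E} {N N' : X ⟶ X} {θ : L ≫ U ⟶ U ≫ N}
  {θ' : L' ≫ U ⟶ U ≫ N'} {n : N ≫ S ⟶ S ≫ N} {n' : N' ≫ S ⟶ S ≫ N'}

theorem unit (ψ : U ≫ S ⟶ 𝟙 E ≫ U) : IsAlgebraLaw ψ (unitLaw U) (Mnd.idLaw S) := by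
  simp [IsAlgebraLaw, act, Mnd.compLaw, Mnd.unitLaw, Mnd.idLaw, unitLaw]

theorem paste (h : IsAlgebraLaw ψ θ n) (h' : IsAlgebraLaw ψ θ' n') :
    IsAlgebraLaw ψ (pasteLaw θ θ') (Mnd.compLaw n n') := by
  unfold IsAlgebraLaw at *
  calc _ = 𝟙 _ ⊗≫ L ◁ (act ψ L' ≫ 𝟙 E ◁ θ') ⊗≫ θ ▷ N' ⊗≫ 𝟙 _ := by
        simp only [act, pasteLaw, Mnd.compLaw, Mnd.unitLaw]; bicategory
    _ = 𝟙 _ ⊗≫ L ◁ θ' ▷ S ⊗≫ (L ≫ U) ◁ n' ⊗≫ (act ψ L ≫ 𝟙 E ◁ θ) ▷ N' ⊗≫ 𝟙 _ := by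
        rw [h']; simp only [act, Mnd.compLaw, Mnd.unitLaw]; bicategory
    _ = 𝟙 _ ⊗≫ L ◁ θ' ▷ S ⊗≫ ((L ≫ U) ◁ n' ≫ θ ▷ (S ≫ N')) ⊗≫ Mnd.compLaw ψ n ▷ N' ⊗≫ 𝟙 _ := by
        rw [h]; bicategory
    _ = _ := by
        rw [whisker_exchange]; simp only [pasteLaw, Mnd.compLaw]; bicategory

/-- The hypothesis on `φ₀` says that it is a `2`-morphism of monad endomorphisms. This makes its
conjugate `θ ≫ U ◁ φ₀ ≫ inv θ'` compatible with the actions, hence the image under `U` of some `φ`.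
-/
theorem exists_isLift (hψ : IsFullyFaithfulOnAlgebras ψ) (h : IsAlgebraLaw ψ θ n)
    (h' : IsAlgebraLaw ψ θ' n') [IsIso θ'] {φ₀ : N ⟶ N'} (hφ₀ : n ≫ S ◁ φ₀ = φ₀ ▷ S ≫ n') :
    ∃ φ : L ⟶ L', IsLift θ θ' φ φ₀ := by
  unfold IsAlgebraLaw at *
  obtain ⟨φ, hφ, -⟩ := hψ.existsUnique (θ ≫ U ◁ φ₀ ≫ inv θ') (by
    rw [← cancel_mono (𝟙 E ◁ θ'), Category.assoc, Category.assoc, h',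
      ← Bicategory.whiskerLeft_comp, ← comp_whiskerRight_assoc]
    simp only [Category.assoc, IsIso.inv_hom_id, Category.comp_id]
    rw [Bicategory.whiskerLeft_comp, reassoc_of% h, Mnd.compLaw_whiskerLeft ψ hφ₀,
      comp_whiskerRight, Category.assoc])
  replace hφ : φ ▷ U = _ := hφ
  exact ⟨φ, by simp [IsLift, hφ]⟩

end IsAlgebraLaw

/-- By definition `act κ.law g` is the law of the composite of `Inc g` with `κ`, so compatibility
with the actions is exactly the condition to be a `2`-morphism of monads. -/
theorem IsUniversal.isFullyFaithfulOnAlgebras [Strict K] {M : Mnd K}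
    {κ : (Mnd.inc K).obj E ⟶ M} (h : IsUniversal (Mnd.inc K) κ) :
    IsFullyFaithfulOnAlgebras (E := E) (X := M.obj) (S := M.S) (U := κ.hom) κ.law where
  existsUnique φ comm := by
    obtain ⟨χ, hχ, hu⟩ := h.existsUnique_hom₂ ⟨φ, comm⟩
    exact ⟨χ, congrArg Mnd.Hom₂.hom hχ, fun χ' hχ' ↦ hu χ' (Mnd.hom₂_ext hχ')⟩

theorem Mnd.Hom.exists_law_eq {M N : Mnd K} {F G : Mnd.Hom M N} (h : F = G) :
    ∃ e : F.hom = G.hom, F.law ≫ M.S ◁ eqToHom e = eqToHom e ▷ N.S ≫ G.law := by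
  subst h; exact ⟨rfl, by simp⟩

end Algebras

/-! ### Endomorphisms of a monad and the lifted tangent data. -/

section MonadLaws

variable {K : Type u} [Bicategory.{w, v} K] {X : K} {S : X ⟶ X} (η : 𝟙 X ⟶ S) (μ : S ≫ S ⟶ S)

/-- The conditions for `n` to make `N` an endomorphism of the monad `(S, η, μ)`. -/
structure IsMonadLaw {N : X ⟶ X} (n : N ≫ S ⟶ S ≫ N) : Prop where
  unit : N ◁ η ≫ n = (ρ_ N).hom ≫ (λ_ N).inv ≫ η ▷ N
  mul : N ◁ μ ≫ n =
    (α_ N S S).inv ≫ n ▷ S ≫ (α_ S N S).hom ≫ S ◁ n ≫ (α_ S S N).inv ≫ μ ▷ N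

variable {η μ}

/-- Both axioms hold for `n` after composing with each `S ◁ π i`, where they become those of `a`.
For the pullbacks `T_n`, pointwiseness is what makes the legs `S ◁ π i` jointly monic. -/
theorem IsMonadLaw.of_jointly_monic {A N : X ⟶ X} {a : A ≫ S ⟶ S ≫ A} (ha : IsMonadLaw η μ a)
    {ι : Type*} {π : ι → (N ⟶ A)}
    (hπ : ∀ {V : X ⟶ X} {u v : V ⟶ S ≫ N}, (∀ i, u ≫ S ◁ π i = v ≫ S ◁ π i) → u = v)
    {n : N ≫ S ⟶ S ≫ N} (hn : ∀ i, n ≫ S ◁ π i = π i ▷ S ≫ a) : IsMonadLaw η μ n := by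
  constructor <;> refine hπ fun i ↦ ?_
  · calc _ = (N ◁ η ≫ π i ▷ S) ≫ a := by rw [Category.assoc, hn, Category.assoc]
      _ = π i ▷ 𝟙 _ ≫ A ◁ η ≫ a := by rw [whisker_exchange, Category.assoc]
      _ = (ρ_ N).hom ≫ (λ_ N).inv ≫ 𝟙 _ ◁ π i ≫ η ▷ A := by rw [ha.unit]; simp
      _ = _ := by rw [whisker_exchange]; simp
  · calc _ = (N ◁ μ ≫ π i ▷ S) ≫ a := by rw [Category.assoc, hn, Category.assoc]
      _ = π i ▷ (S ≫ S) ≫ A ◁ μ ≫ a := by rw [whisker_exchange, Category.assoc]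
      _ = (α_ N S S).inv ≫ (π i ▷ S ≫ a) ▷ S ≫ (α_ S A S).hom ≫
          S ◁ a ≫ (α_ S S A).inv ≫ μ ▷ A := by rw [ha.mul]; simp
      _ = (α_ N S S).inv ≫ n ▷ S ≫ (α_ S N S).hom ≫ S ◁ (π i ▷ S ≫ a) ≫
          (α_ S S A).inv ≫ μ ▷ A := by rw [← hn i, comp_whiskerRight, hn i]; simp
      _ = (α_ N S S).inv ≫ n ▷ S ≫ (α_ S N S).hom ≫ S ◁ n ≫
          (α_ S S N).inv ≫ ((S ≫ S) ◁ π i ≫ μ ▷ A) := by rw [← hn i]; simp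
      _ = _ := by rw [whisker_exchange]; simp

/-- The change of viewpoint on a tangent monad: the equations saying that `η` and `μ` are tangent
`2`-morphisms are the same as those making `(T, α)` an endomorphism of the monad. -/
theorem IsMonadLaw.of_comm {T : X ⟶ X} {α : T ≫ S ⟶ S ≫ T}
    (hη : idLaw T ≫ η ▷ T = T ◁ η ≫ α) (hμ : compLaw α α ≫ μ ▷ T = T ◁ μ ≫ α) :
    IsMonadLaw η μ α where
  unit := by rw [← hη, idLaw, Category.assoc]
  mul := by rw [← hμ, compLaw]; simp only [Category.assoc]

/-- Every endomorphism of the monad `(S, η, μ)` lifts strictly along `U`. -/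
def LiftsMonadLaws (η : 𝟙 X ⟶ S) (μ : S ≫ S ⟶ S) {E : K} {U : E ⟶ X}
    (ψ : U ≫ S ⟶ 𝟙 E ≫ U) : Prop :=
  ∀ {N : X ⟶ X} (n : N ≫ S ⟶ S ≫ N), IsMonadLaw η μ n →
    ∃ (L : E ⟶ E) (e : L ≫ U = U ≫ N), IsAlgebraLaw ψ (eqToHom e) n

/-- The endomorphism `(N, n)` composed after `κ` is again an arrow from `Inc E` to `M`. Its
factorization through `κ` is `L`: equality of `1`-morphisms gives strictness, and equality of laws
gives the algebra law. -/
theorem IsUniversal.liftsMonadLaws [Strict K] {M : Mnd K} {E : K}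
    {κ : (Mnd.inc K).obj E ⟶ M} (h : IsUniversal (Mnd.inc K) κ) :
    LiftsMonadLaws (X := M.obj) (E := E) M.η M.μ (U := κ.hom) κ.law := by
  intro N n hn
  let N' : Mnd.Hom M M := ⟨N, n, hn.unit, hn.mul⟩
  obtain ⟨L, hL, -⟩ := h.existsUnique_hom (Mnd.Hom.comp κ N')
  obtain ⟨e, he⟩ := Mnd.Hom.exists_law_eq hL
  exact ⟨L, e, he⟩

variable {t : TangentStructure X} {α : t.T ≫ S ⟶ S ≫ t.T} {E : K} {U : E ⟶ X}
  {ψ : U ≫ S ⟶ 𝟙 E ≫ U}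

/-- The tangent structure on `X` lifts along `U` when `S` is a tangent monad on `X`. -/
theorem exists_tangentLift (hS : IsLaxLaw t t S α) (hα : IsMonadLaw η μ α)
    (hψ : IsFullyFaithfulOnAlgebras ψ) (hl : LiftsMonadLaws η μ ψ) :
    ∃ (d : TangentData E) (h : TangentLift t U d) (e : d.T ≫ U = U ≫ t.T),
      IsAlgebraLaw ψ h.law α ∧ h.law = eqToHom e := by
  obtain ⟨ap, az, α₂, a₁, a₂, as⟩ := (isAdditiveHom_iff ..).1 hS.additive
  have hα₂ : IsMonadLaw η μ α₂ := hα.of_jointly_monic (ι := Bool)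
    (π := fun j ↦ match j with | true => t.π₁ | false => t.π₂)
    (fun huv ↦ (t.isPullback_whiskerLeft S).hom_ext (huv true) (huv false))
    (fun j ↦ match j with | true => a₁ | false => a₂)
  obtain ⟨T, e, hT⟩ := hl α hα
  obtain ⟨T₂, e₂, hT₂⟩ := hl α₂ hα₂
  have h1 := IsAlgebraLaw.unit ψ
  -- From here on, each clause of the laxness of `S` is read as saying that a structural
  -- `2`-morphism respects the laws `α`, `α₂` and their composites, and so lifts to `E`.
  obtain ⟨p, hp⟩ := hT.exists_isLift hψ h1 (φ₀ := t.p) ap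
  obtain ⟨z, hz⟩ := h1.exists_isLift hψ hT (φ₀ := t.z) az.symm
  obtain ⟨π₁, hπ₁⟩ := hT₂.exists_isLift hψ hT (φ₀ := t.π₁) a₁
  obtain ⟨π₂, hπ₂⟩ := hT₂.exists_isLift hψ hT (φ₀ := t.π₂) a₂
  obtain ⟨s, hs⟩ := hT₂.exists_isLift hψ hT (φ₀ := t.s) as.symm
  obtain ⟨l, hl'⟩ := hT.exists_isLift hψ (hT.paste hT) (φ₀ := t.l) hS.lift.symm
  obtain ⟨c, hc⟩ := (hT.paste hT).exists_isLift hψ (hT.paste hT) (φ₀ := t.c) hS.flip.symm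
  refine ⟨⟨T, T₂, p, π₁, π₂, z, s, l, c⟩,
    { law := eqToHom e
      law₂ := eqToHom e₂
      isIso_law := inferInstance
      isIso_law₂ := inferInstance
      p := hp
      π₁ := hπ₁
      π₂ := hπ₂
      z := hz
      s := hs
      l := hl'
      c := hc
      exists_pullback := ?_ }, e, hT, rfl⟩
  intro n hn
  obtain ⟨Tn, π, b, hTn⟩ := t.exists_pullback n hn
  have hb : IsNFoldPullback t.p π b := isNFoldPullback_of_whiskerBoth (hTn X (𝟙 X) 0)
  have hSn : IsNFoldPullback (S ◁ t.p) (fun i ↦ S ◁ π i) (S ◁ b) :=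
    isNFoldPullback_whiskerRight_id_iff.1 (hTn X S 0)
  obtain ⟨αn, hαn, -⟩ := hSn.exists_lift (fun i ↦ π i ▷ S ≫ α) (b ▷ S ≫ unitLaw S) (fun i ↦ by
    rw [Category.assoc, ap, ← comp_whiskerRight_assoc, hb.w])
  have hmono : ∀ {V : X ⟶ X} {u v : V ⟶ S ≫ Tn}, (∀ i, u ≫ S ◁ π i = v ≫ S ◁ π i) → u = v := by
    intro V u v huv
    refine hSn.hom_ext huv ?_
    -- As `n > 0`, the base leg factors through leg `0`, so the projections alone are jointly monic.
    rw [← hSn.w ⟨0, hn⟩, ← Category.assoc, huv, Category.assoc]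
  obtain ⟨Ln, en, hLn⟩ := hl αn (hα.of_jointly_monic hmono hαn)
  choose π' hπ' using fun i ↦ hLn.exists_isLift hψ hT (φ₀ := π i) (hαn i)
  -- The base leg upstairs is defined through leg `0`, again using `n > 0`.
  refine ⟨Tn, π, b, Ln, π', π' ⟨0, hn⟩ ≫ p, eqToHom en, hTn, inferInstance, hπ', ?_⟩
  rw [← hb.w ⟨0, hn⟩]
  exact (hπ' _).comp hp

end MonadLaws

/-! ### Reflecting lax distributive laws along `U`. -/

section LaxLaws

variable {K : Type u} [Bicategory.{w, v} K] {E X : K} {U : E ⟶ X}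

namespace IsReflecting

/-- A converse to `compLaw_square`: up to associators, `compLaw γ θ` is `γ ▷ U` followed by `G ◁ θ`.
Invertibility of `θ'` and faithfulness of `▷ U` then permit cancellation. -/
theorem square_of_compLaw (hU : IsReflecting U) {Z : K} {G : Z ⟶ E} {P Q : Z ⟶ Z} {L L' : E ⟶ E}
    {N N' : X ⟶ X} {θ : L ≫ U ⟶ U ≫ N} {θ' : L' ≫ U ⟶ U ≫ N'} [IsIso θ'] {γ : P ≫ G ⟶ G ≫ L}
    {γ' : Q ≫ G ⟶ G ≫ L'} {φ : P ⟶ Q} {χ : L ⟶ L'} {χ₀ : N ⟶ N'} (hχ : IsLift θ θ' χ χ₀)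
    (h : φ ▷ (G ≫ U) ≫ compLaw γ' θ' = compLaw γ θ ≫ (G ≫ U) ◁ χ₀) :
    φ ▷ G ≫ γ' = γ ≫ G ◁ χ := by
  unfold IsLift at hχ
  refine hU.whiskerRight_injective ?_
  rw [← cancel_mono ((α_ G L' U).hom ≫ G ◁ θ' ≫ (α_ G U N').inv)]
  calc _ = (α_ P G U).hom ≫ φ ▷ (G ≫ U) ≫ compLaw γ' θ' := by simp [compLaw]
    _ = γ ▷ U ≫ (α_ G L U).hom ≫ G ◁ (θ ≫ U ◁ χ₀) ≫ (α_ G U N').inv := by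
        rw [h]; simp [compLaw]
    _ = _ := by rw [← hχ]; simp

theorem comm_of_compLaw (hU : IsReflecting U) {Z : K} {G H : Z ⟶ E} {P : Z ⟶ Z} {L : E ⟶ E}
    {N : X ⟶ X} {θ : L ≫ U ⟶ U ≫ N} [IsIso θ] {γ : P ≫ G ⟶ G ≫ L} {γ' : P ≫ H ⟶ H ≫ L}
    {φ : G ⟶ H} (h : compLaw γ θ ≫ (φ ▷ U) ▷ N = P ◁ (φ ▷ U) ≫ compLaw γ' θ) :
    γ ≫ φ ▷ L = P ◁ φ ≫ γ' := by
  refine hU.whiskerRight_injective ?_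
  rw [← cancel_mono ((α_ H L U).hom ≫ H ◁ θ ≫ (α_ H U N).inv)]
  calc _ = γ ▷ U ≫ (α_ _ _ _).hom ≫ (φ ▷ (L ≫ U) ≫ H ◁ θ) ≫ (α_ _ _ _).inv := by simp
    _ = (α_ P G U).hom ≫ compLaw γ θ ≫ (φ ▷ U) ▷ N := by
        rw [← whisker_exchange]; simp [compLaw]
    _ = _ := by rw [h]; simp [compLaw]

theorem compLaw_injective (hU : IsReflecting U) {Z : K} {G : Z ⟶ E} {P : Z ⟶ Z} {L : E ⟶ E}
    {N : X ⟶ X} {θ : L ≫ U ⟶ U ≫ N} [IsIso θ] {γ γ' : P ≫ G ⟶ G ≫ L}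
    (h : compLaw γ θ = compLaw γ' θ) : γ = γ' := by
  have := hU.comm_of_compLaw (φ := 𝟙 G) (γ := γ) (γ' := γ') (θ := θ) (by simp [h])
  simpa using this

end IsReflecting

namespace TangentLift

variable {t : TangentStructure X} {d : TangentData E}

theorem isLaxLaw (h : TangentLift t U d) (hU : IsReflecting U) :
    IsLaxLaw (h.tangentStructure hU) t U h.law where
  additive := (isAdditiveHom_iff ..).2
    ⟨h.p.symm, h.z, h.law₂, h.π₁.symm, h.π₂.symm, h.s⟩
  lift := h.l
  flip := h.c

/-- A law whose composite with a lifted law is lax is itself lax. -/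
theorem isLaxLaw_of_compLaw (h : TangentLift t U d) (hU : IsReflecting U) {Z : K}
    {tZ : TangentStructure Z} {G : Z ⟶ E} {γ : tZ.T ≫ G ⟶ G ≫ d.T}
    (hγ : IsLaxLaw tZ t (G ≫ U) (compLaw γ h.law)) : IsLaxLaw tZ (h.tangentStructure hU) G γ where
  additive := by
    obtain ⟨hp, hz, β₂, hβ₁, hβ₂, hs⟩ := (isAdditiveHom_iff ..).1 hγ.additive
    have ep : tZ.p ▷ G ≫ unitLaw G = γ ≫ G ◁ d.p :=
      hU.square_of_compLaw h.p (by rw [compLaw_unitLaw, hp])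
    have ez : tZ.z ▷ G ≫ γ = unitLaw G ≫ G ◁ d.z :=
      hU.square_of_compLaw h.z (by rw [compLaw_unitLaw, hz])
    have q : IsPullback (G ◁ d.π₁) (G ◁ d.π₂) (G ◁ d.p) (G ◁ d.p) :=
      (h.tangentStructure hU).isPullback_whiskerLeft G
    have w : tZ.π₁ ≫ tZ.p = tZ.π₂ ≫ tZ.p := tZ.additive.isPullback.w
    obtain ⟨γ₂, h₁, h₂⟩ := q.exists_lift (tZ.π₁ ▷ G ≫ γ) (tZ.π₂ ▷ G ≫ γ) (by
      rw [Category.assoc, ← ep, ← comp_whiskerRight_assoc, w, Category.assoc, ← ep,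
        ← comp_whiskerRight_assoc])
    -- `γ₂` comes from the pullback upstairs, so it must still be identified with the given `β₂`;
    -- both have the same projections.
    have e : compLaw γ₂ h.law₂ = β₂ := (t.isPullback_whiskerLeft (G ≫ U)).hom_ext
      ((compLaw_square h₁.symm h.π₁).symm.trans hβ₁.symm)
      ((compLaw_square h₂.symm h.π₂).symm.trans hβ₂.symm)
    refine (isAdditiveHom_iff ..).2 ⟨ep.symm, ez, γ₂, h₁, h₂, ?_⟩
    exact hU.square_of_compLaw h.s (by rw [e, hs])
  lift := by
    have e := hγ.lift
    rw [lawSq_compLaw] at e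
    exact hU.square_of_compLaw (θ' := pasteLaw h.law h.law) h.l e
  flip := by
    have e := hγ.flip
    rw [lawSq_compLaw] at e
    exact hU.square_of_compLaw (θ' := pasteLaw h.law h.law) h.c e

theorem comm_of_compLaw (h : TangentLift t U d) (hU : IsReflecting U) {Z : K} {G H : Z ⟶ E}
    {P : Z ⟶ Z} {γ : P ≫ G ⟶ G ≫ d.T} {γ' : P ≫ H ⟶ H ≫ d.T} {φ : G ⟶ H}
    (e : compLaw γ h.law ≫ (φ ▷ U) ▷ t.T = P ◁ (φ ▷ U) ≫ compLaw γ' h.law) :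
    γ ≫ φ ▷ d.T = P ◁ φ ≫ γ' :=
  hU.comm_of_compLaw e

end TangentLift

variable {S : X ⟶ X} {ψ : U ≫ S ⟶ 𝟙 E ≫ U}

/-- Compatibility of a law with an action, as a condition for the action to be a tangent
`2`-morphism. -/
theorem IsAlgebraLaw.comm {L : E ⟶ E} {N : X ⟶ X} {θ : L ≫ U ⟶ U ≫ N} {n : N ≫ S ⟶ S ≫ N}
    (h : IsAlgebraLaw ψ θ n) : compLaw θ n ≫ ψ ▷ N = L ◁ ψ ≫ compLaw (idLaw L) θ := by
  unfold IsAlgebraLaw at h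
  calc _ = (α_ L U S).inv ≫ (θ ▷ S ≫ Mnd.compLaw ψ n) ≫ (α_ (𝟙 E) U N).inv := by
        simp [compLaw, Mnd.compLaw]
    _ = _ := by rw [← h]; simp [act, compLaw, idLaw, Mnd.compLaw, Mnd.unitLaw]

/-- The hypothesis on `β`, that the action is a tangent `2`-morphism, unwinds to compatibility of
`β` with the actions (`key`). The law `θ` precomposed with `G` is compatible as well (`key'`), so
`β` followed by its inverse has the form `γ ▷ U`. -/
theorem IsAlgebraLaw.exists_compLaw_eq {L : E ⟶ E} {N : X ⟶ X} {θ : L ≫ U ⟶ U ≫ N} [IsIso θ]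
    {n : N ≫ S ⟶ S ≫ N} (h : IsAlgebraLaw ψ θ n) (hψ : IsFullyFaithfulOnAlgebras ψ) {Z : K}
    {G : Z ⟶ E} {P : Z ⟶ Z} (β : P ≫ G ≫ U ⟶ (G ≫ U) ≫ N)
    (hβ : compLaw β n ≫ act ψ G ▷ N = P ◁ act ψ G ≫ compLaw (idLaw P) β) :
    ∃ γ : P ≫ G ⟶ G ≫ L, compLaw γ θ = β := by
  unfold IsAlgebraLaw at h
  have key : act ψ (P ≫ G) ≫ 𝟙 Z ◁ ((α_ P G U).hom ≫ β) =
      ((α_ P G U).hom ≫ β) ▷ S ≫ Mnd.compLaw (act ψ G) n := by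
    calc _ = 𝟙 _ ⊗≫ (P ◁ act ψ G ≫ compLaw (idLaw P) β) ⊗≫ 𝟙 _ := by
          simp only [act, compLaw, idLaw, Mnd.compLaw, Mnd.unitLaw]; bicategory
      _ = _ := by rw [← hβ]; simp only [compLaw, Mnd.compLaw]; bicategory
  have key' : act ψ (G ≫ L) ≫ 𝟙 Z ◁ (whiskerLaw G θ).hom =
      (whiskerLaw G θ).hom ▷ S ≫ Mnd.compLaw (act ψ G) n := by
    calc _ = 𝟙 _ ⊗≫ G ◁ (act ψ L ≫ 𝟙 E ◁ θ) ⊗≫ 𝟙 _ := by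
          simp only [act, whiskerLaw, Mnd.compLaw, Mnd.unitLaw, Iso.trans_hom,
            whiskerLeftIso_hom, asIso_hom, Iso.symm_hom]; bicategory
      _ = _ := by
          rw [h]
          simp only [act, whiskerLaw, Mnd.compLaw, Mnd.unitLaw, Iso.trans_hom,
            whiskerLeftIso_hom, asIso_hom, Iso.symm_hom]; bicategory
  obtain ⟨γ, hγ, -⟩ := hψ.existsUnique ((α_ P G U).hom ≫ β ≫ (whiskerLaw G θ).inv) (by
    rw [← cancel_mono (𝟙 Z ◁ (whiskerLaw G θ).hom), Category.assoc, Category.assoc, key',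
      ← Bicategory.whiskerLeft_comp, ← comp_whiskerRight_assoc]
    simp only [Category.assoc, Iso.inv_hom_id, Category.comp_id]
    exact key)
  replace hγ : γ ▷ U = _ := hγ
  refine ⟨γ, ?_⟩
  calc _ = (α_ P G U).inv ≫ γ ▷ U ≫ (whiskerLaw G θ).hom := by simp [compLaw, whiskerLaw]
    _ = β := by rw [hγ]; simp

end LaxLaws

/-! ### `2`-universal arrows to tangent monads. -/

section TangentMonads

variable {K : Type u} [Bicategory.{w, v} K] [Strict K] {M : Mnd (Tng K)} {E : K}
  {κ : (Mnd.inc K).obj E ⟶ M.underlying}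

/-- A `2`-universal arrow to the underlying monad of a tangent monad lifts to a `2`-universal arrow
to the tangent monad. -/
theorem IsUniversal.exists_tangentLift (h : IsUniversal (Mnd.inc K) κ) :
    ∃ (t : TangentStructure E) (k : Mnd.trivial (⟨E, t⟩ : Tng K) ⟶ M),
      Mnd.underlyingHom k = κ ∧ k.hom.IsStrict ∧
        IsUniversal (Mnd.inc (Tng K)) (E := (⟨E, t⟩ : Tng K)) k := by
  obtain ⟨U, ψ, hu, hm⟩ := κ
  change E ⟶ M.obj.obj at U
  have hψ : IsFullyFaithfulOnAlgebras (S := M.S.hom) (U := U) ψ := h.isFullyFaithfulOnAlgebras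
  have hU := hψ.isReflecting
  have hl : LiftsMonadLaws (S := M.S.hom) M.η.hom M.μ.hom (U := U) ψ := h.liftsMonadLaws
  obtain ⟨d, ℓ, e, hd, he⟩ := Tangent.exists_tangentLift M.S.isLaxLaw
    (.of_comm M.η.comm M.μ.comm) hψ hl
  let t : TangentStructure E := ℓ.tangentStructure hU
  let U' : Tng.Hom (⟨E, t⟩ : Tng K) M.obj := ⟨U, ℓ.law, ℓ.isLaxLaw hU⟩
  -- The monad axioms are inherited from `κ`, since tangent `2`-morphisms are equal when their
  -- underlying `2`-morphisms are. The only new requirement is that `ψ` be a tangent `2`-morphism.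
  let k : Mnd.Hom (Mnd.trivial (⟨E, t⟩ : Tng K)) M :=
    { hom := U'
      law := ⟨ψ, hd.comm⟩
      unit := Tng.hom₂_ext hu
      mul := Tng.hom₂_ext hm }
  refine ⟨t, k, rfl, ⟨e, he⟩, ?_, ?_⟩
  · intro Z f
    obtain ⟨⟨F, β, hβ⟩, ⟨a, ha⟩, fu, fm⟩ := f
    -- Forgetting the tangent data, `f` factors through `κ` in `K`; what remains is to lift the lax
    -- law `β` to `G`.
    obtain ⟨G, hG, hGu⟩ := h.existsUnique_hom
      (⟨F, a, congrArg Tng.Hom₂.hom fu, congrArg Tng.Hom₂.hom fm⟩ :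
        Mnd.Hom (Mnd.trivial Z.obj) M.underlying)
    obtain ⟨eF, ea⟩ := (Mnd.Hom.mk.injEq ..).mp hG
    change G ≫ U = F at eF
    subst eF
    replace ea : act (S := M.S.hom) ψ G = a := eq_of_heq ea
    subst ea
    obtain ⟨γ, hγ⟩ := hd.exists_compLaw_eq hψ β ha
    subst hγ
    let g : Tng.Hom Z (⟨E, t⟩ : Tng K) := ⟨G, γ, ℓ.isLaxLaw_of_compLaw hU hβ⟩
    refine ⟨g, rfl, ?_⟩
    rintro ⟨G', γ', hγ'⟩ hg'
    obtain rfl : G' = G := hGu G' (congrArg Mnd.underlyingHom hg')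
    obtain ⟨eF, -⟩ := (Mnd.Hom.mk.injEq ..).mp hg'
    obtain ⟨-, eβ⟩ := (Tng.Hom.mk.injEq ..).mp eF
    obtain rfl : γ' = γ := hU.compLaw_injective (θ := ℓ.law) (eq_of_heq eβ)
    rfl
  · intro Z g g' φ
    obtain ⟨χ, hχ, hχu⟩ := h.existsUnique_hom₂ (g := g.hom) (h := g'.hom)
      ⟨φ.hom.hom, congrArg Tng.Hom₂.hom φ.comm⟩
    replace hχ : χ ▷ U = φ.hom.hom := congrArg Mnd.Hom₂.hom hχ
    -- The factorization `χ` is found in `K`; it is a tangent `2`-morphism because `χ ▷ U` is one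
    -- and `U` is faithful.
    have comm : compLaw g.law ℓ.law ≫ (χ ▷ U) ▷ M.obj.str.T =
        Z.str.T ◁ (χ ▷ U) ≫ compLaw g'.law ℓ.law := by
      rw [hχ]; exact φ.hom.comm
    refine ⟨⟨χ, ℓ.comm_of_compLaw hU comm⟩, Mnd.hom₂_ext (Tng.hom₂_ext hχ), fun χ' hχ' ↦ ?_⟩
    exact Tng.hom₂_ext (hU.whiskerRight_injective (U := U)
      ((congrArg (fun x ↦ Tng.Hom₂.hom (Mnd.Hom₂.hom x)) hχ').trans hχ.symm))

end TangentMonads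

end Tangent

/-! ### The construction of algebras for tangentads. -/

theorem mainTheorem2 {K : Type u} [Bicategory.{w, v} K] [Bicategory.Strict K] :
    (Tangent.AdmitsAlgebras K → Tangent.AdmitsAlgebras (Tangent.Tng K)) ∧
    ∀ A : Tangent.AlgebraConstruction K,
      ∃ A' : Tangent.AlgebraConstruction (Tangent.Tng K),
        ∀ M : Tangent.Mnd (Tangent.Tng K),
          ∃ (t : Tangent.TangentStructure (A.alg M.underlying))
            (U : Tangent.Mnd.trivial (⟨A.alg M.underlying, t⟩ : Tangent.Tng K) ⟶ M),
            (⟨A'.alg M, A'.forget M⟩ : (E : Tangent.Tng K) × (Tangent.Mnd.trivial E ⟶ M)) =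
              ⟨⟨A.alg M.underlying, t⟩, U⟩ ∧
            Tangent.Mnd.underlyingHom U = A.forget M.underlying ∧
            U.hom.IsStrict := by
  have key : ∀ A : Tangent.AlgebraConstruction K,
      ∃ A' : Tangent.AlgebraConstruction (Tangent.Tng K),
        ∀ M : Tangent.Mnd (Tangent.Tng K),
          ∃ (t : Tangent.TangentStructure (A.alg M.underlying))
            (U : Tangent.Mnd.trivial (⟨A.alg M.underlying, t⟩ : Tangent.Tng K) ⟶ M),
            (⟨A'.alg M, A'.forget M⟩ : (E : Tangent.Tng K) × (Tangent.Mnd.trivial E ⟶ M)) =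
              ⟨⟨A.alg M.underlying, t⟩, U⟩ ∧
            Tangent.Mnd.underlyingHom U = A.forget M.underlying ∧
            U.hom.IsStrict := by
    intro A
    choose t U hU hs hu using fun M : Tangent.Mnd (Tangent.Tng K) ↦
      (A.isUniversal_counitApp M.underlying).exists_tangentLift
    -- The objects and counit of the adjoint built from universal arrows are by definition the
    -- chosen ones, so the required identification is `rfl`.
    exact ⟨Tangent.IsUniversal.rightTwoAdjoint hu, fun M ↦ ⟨t M, U M, rfl, hU M, hs M⟩⟩
  exact ⟨fun ⟨A⟩ ↦ ⟨(key A).choose⟩, key⟩
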